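/- Let $F$ be a probability distribution on the Borel sets of $\mathbb R$. Its Fisher information of scale is $$\mathcal I_{s1}(F):=\sup_{\varphi}\frac{\bigl(\int x\,\varphi'(x)\,F(dx)\bigr)^2}{\int\varphi^2(x)\,F(dx)}\in[0,\infty],$$ where $\varphi$ ranges over all differentiable functions $\varphi:\mathbb R\to\mathbb R$ whose derivative is continuous with compact support, and where $0/0:=0$ and $a/0:=\infty$ for $a>0$. For $\sigma>0$ let $F_\sigma$ be the distribution with distribution function $x\mapsto F(x/\sigma)$, and let $F_0:=F-F(\{0\})\,\delta_0$ be $F$ with its mass at zero removed. Assume that $\mathcal I_{s1}(F)<\infty$. Then $F_0$ has a Lebesgue density $f\ge 0$ for which $x\mapsto x f(x)$ is absolutely continuous on $\mathbb R$; and for any such $f$, setting $\Lambda(x):=-[x f(x)]'/f(x)$ for $x\neq 0$, $\Lambda(0):=0$, and $\Lambda_\sigma(x):=\sigma^{-1}\Lambda(x/\sigma)$ (with an arbitrary fixed value, such as $0$, for $\Lambda$ at the points $x\ne0$ where this quotient is undefined; these form an $F$-null set), the scale model $(F_\sigma)_{0<\sigma<\infty}$ is $L_2$-differentiable with derivative $\Lambda_\sigma$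 at every $0<\sigma<\infty$, that is, $\int\Lambda_\sigma^2\,dF_\sigma<\infty$ and $$\Bigl\|\sqrt{dF_{\sigma+t}}-\sqrt{dF_\sigma}\,\bigl(1+\tfrac12 t\Lambda_\sigma\bigr)\Bigr\|=o(t)\qquad\text{as }t\to0 .$$ Here $\|\sqrt{dQ}-g\sqrt{dP}\|$ denotes the $L_2(\mu)$-norm of $\sqrt{dQ/d\mu}-g\sqrt{dP/d\mu}$ for any $\sigma$-finite measure $\mu$ dominating $Q$ and $P$ (it does not depend on $\mu$). In particular, $F$ may have an atom at $0$. -/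

import Mathlib

open MeasureTheory Filter Topology Asymptotics
open scoped ENNReal

noncomputable section

/-- The test class: differentiable functions `φ : ℝ → ℝ` whose derivative is continuous and has
compact support (`φ` itself need not have compact support, but it is bounded). -/
def scaleTestFunctions : Set (ℝ → ℝ) :=
  {φ | Differentiable ℝ φ ∧ Continuous (deriv φ) ∧ HasCompactSupport (deriv φ)}

/-- Fisher information of scale of a distribution `F` on the real line,
`sup_φ (∫ x φ'(x) F(dx))² / ∫ φ² dF`, as an extended nonnegative number.
For finite `F` all the integrands are bounded and hence integrable. In `ℝ≥0∞` one has `0 / 0 = 0`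
and `a / 0 = ∞` for `a ≠ 0`. -/
def fisherInfoScale (F : Measure ℝ) : ℝ≥0∞ :=
  ⨆ φ ∈ scaleTestFunctions,
    ENNReal.ofReal ((∫ x, x * deriv φ x ∂F) ^ 2) / ENNReal.ofReal (∫ x, φ x ^ 2 ∂F)

/-- The scale family induced by `F`: for `σ > 0`, `F_σ` has distribution function `x ↦ F (x / σ)`,
that is, `F_σ` is the law of `σ X` for `X ∼ F`. (Only `σ > 0` matters.) -/
def scaleFamily (F : Measure ℝ) (σ : ℝ) : Measure ℝ :=
  F.map (fun x => σ * x)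

/-- The punctured measure `F₀ = F - F({0}) δ₀`, i.e. `F` with its mass at zero removed. -/
def puncture (F : Measure ℝ) : Measure ℝ :=
  F.restrict {0}ᶜ

/-- Absolute continuity of a function on the whole real line: for every `ε > 0` there is `δ > 0`
such that `∑ |m (b i) - m (a i)| < ε` for any finite collection of disjoint segments
`(a i, b i]` of total length less than `δ`. -/
def AbsolutelyContinuousOnLine (m : ℝ → ℝ) : Prop :=
  ∀ ε : ℝ, 0 < ε → ∃ δ : ℝ, 0 < δ ∧ ∀ (n : ℕ) (a b : Fin n → ℝ),
    (∀ i, a i ≤ b i) →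
    (∀ i j, i ≠ j → Disjoint (Set.Ioc (a i) (b i)) (Set.Ioc (a j) (b j))) →
    ∑ i, (b i - a i) < δ →
    ∑ i, |m (b i) - m (a i)| < ε

/-- `f` is a (Lebesgue) density of the punctured measure `F₀` in the version for which
`x ↦ x f(x)` is absolutely continuous. -/
structure IsScaleDensity (F : Measure ℝ) (f : ℝ → ℝ) : Prop where
  measurable : Measurable f
  nonneg : ∀ x, 0 ≤ f x
  density : puncture F = volume.withDensity (fun x => ENNReal.ofReal (f x))
  absCont : AbsolutelyContinuousOnLine (fun x => x * f x)

/-- The score function `Λ(x) = -[x f(x)]' / f(x)` for `x ≠ 0`, and `Λ(0) = 0`. -/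
def scaleScore (f : ℝ → ℝ) (x : ℝ) : ℝ :=
  if x = 0 then 0 else -deriv (fun y => y * f y) x / f x

/-- The score function at scale `σ`: `Λ_σ(x) = σ⁻¹ Λ(x / σ)`. -/
def scaleScoreAt (f : ℝ → ℝ) (σ : ℝ) (x : ℝ) : ℝ :=
  σ⁻¹ * scaleScore f (x / σ)

/-- The norm `‖√dQ - g √dP‖` in the Hilbert space of square roots of measures: with densities
`q`, `p` of `Q`, `P` with respect to a dominating measure `μ`, it is the `L₂(μ)` norm of
`√q - g √p`, which does not depend on the choice of `μ`; we take `μ = Q + P`. -/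
def sqrtMeasureDist (Q P : Measure ℝ) (g : ℝ → ℝ) : ℝ≥0∞ :=
  eLpNorm
    (fun x => √(Q.rnDeriv (Q + P) x).toReal - √(P.rnDeriv (Q + P) x).toReal * g x)
    2 (Q + P)

/-- `L₂`-differentiability at `θ`, with derivative `L`, of a family `P` of distributions with a
real parameter: `L ∈ L₂(P_θ)` and `‖√dP_{θ+t} - √dP_θ (1 + t L / 2)‖ = o(t)` as `t → 0`.
(Since `L ∈ L₂(P_θ)`, the norm is finite.) -/
def HasL2DerivAt (P : ℝ → Measure ℝ) (L : ℝ → ℝ) (θ : ℝ) : Prop :=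
  MemLp L 2 (P θ) ∧
    (fun t : ℝ => (sqrtMeasureDist (P (θ + t)) (P θ) (fun x => 1 + t / 2 * L x)).toReal)
      =o[𝓝 0] (fun t : ℝ => t)

end

/-! Finite information says that `φ ↦ ∫ x φ' dF` is bounded in the norm of `L₂(F)`, so Riesz
representation gives `g ∈ L₂(F)` with `∫ x φ' dF = -∫ φ g dF` (`exists_dual_score`). Hence, as a
distribution, the signed measure `x F(dx)` has derivative `g dF`. It therefore has the bounded
density `M(y) = -∫_{[y,∞)} g dF`, and `F` is absolutely continuous off the origin. Test functions
concentrating at `0` show that `g dF` has no atom there, so `M` is an indefinite integral of `g f`,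
where `M(x) = x f(x)` and the score is `-g` wherever `f > 0` almost everywhere
(`exists_isScaleDensity_and_score`).

For differentiability, convergence of the difference quotients of `σ ↦ √f_σ` in `L₂` is deduced from
two facts. They converge pointwise almost everywhere where the limit is nonzero, and their norms are
asymptotically at most the norm of the limit; `tendsto_lintegral_sq_sub_of_le` turns this into
strong convergence. The norm bound is the Hellinger estimate `lintegral_sq_sqrt_scaled_sub_le`,
whose constant is sharp as the two scales merge. The atom at `0` is the same for all scales and
drops out. -/

/-! ### Test functions and the dual score. -/

lemma scaleTestFunctions.exists_bound {φ : ℝ → ℝ} (hφ : φ ∈ scaleTestFunctions) :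
    ∃ C, ∀ x, ‖φ x‖ ≤ C := by
  obtain ⟨hd, hc, hs⟩ := hφ
  have hint : Integrable (deriv φ) := hc.integrable_of_hasCompactSupport hs
  refine ⟨‖φ 0‖ + ∫ y, ‖deriv φ y‖, fun x => ?_⟩
  have h1 : φ x = φ 0 + ∫ y in (0 : ℝ)..x, deriv φ y := by
    rw [intervalIntegral.integral_deriv_eq_sub (fun y _ => hd y) (hc.intervalIntegrable _ _)]
    ring
  rw [h1]
  refine (norm_add_le _ _).trans (add_le_add_right ?_ _)
  exact intervalIntegral.norm_integral_le_integral_norm_uIoc.trans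
    (setIntegral_le_integral hint.norm (Eventually.of_forall fun _ => norm_nonneg _))

lemma scaleTestFunctions.memLp {φ : ℝ → ℝ} (hφ : φ ∈ scaleTestFunctions)
    (F : Measure ℝ) [IsFiniteMeasure F] (p : ℝ≥0∞) : MemLp φ p F := by
  obtain ⟨C, hC⟩ := scaleTestFunctions.exists_bound hφ
  exact MemLp.of_bound hφ.1.continuous.aestronglyMeasurable C (Eventually.of_forall hC)

lemma scaleTestFunctions.integrable_mul_deriv {φ : ℝ → ℝ} (hφ : φ ∈ scaleTestFunctions)
    (F : Measure ℝ) [IsFiniteMeasure F] : Integrable (fun x => x * deriv φ x) F :=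
  (continuous_id.mul hφ.2.1).integrable_of_hasCompactSupport hφ.2.2.mul_left

/-- The test class as a linear subspace of the functions on the line. -/
def scaleTestSpace : Submodule ℝ (ℝ → ℝ) where
  carrier := scaleTestFunctions
  add_mem' := by
    intro φ ψ hφ hψ
    have h : deriv (φ + ψ) = deriv φ + deriv ψ := by
      ext x; exact deriv_add (hφ.1 x) (hψ.1 x)
    exact ⟨hφ.1.add hψ.1, by rw [h]; exact hφ.2.1.add hψ.2.1, by rw [h]; exact hφ.2.2.add hψ.2.2⟩
  zero_mem' := by
    have h : deriv (0 : ℝ → ℝ) = 0 := by ext x; exact deriv_const x (0 : ℝ)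
    exact ⟨differentiable_const _, by rw [h]; exact continuous_const,
      by rw [h]; exact HasCompactSupport.zero⟩
  smul_mem' := by
    intro c φ hφ
    have h : deriv (c • φ) = c • deriv φ := by
      ext x; exact deriv_const_smul c (hφ.1 x)
    exact ⟨hφ.1.const_smul c, by rw [h]; exact hφ.2.1.const_smul c,
      by rw [h]; exact hφ.2.2.smul_left (f := fun _ => c)⟩

/-- Clearing the denominator is legitimate even when `∫ φ² dF = 0`: since `a / 0 = ∞`, finiteness of
the supremum forces the numerator to vanish too. -/
lemma sq_integral_mul_deriv_le (F : Measure ℝ) [IsFiniteMeasure F]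
    (hF : fisherInfoScale F < ∞) {φ : ℝ → ℝ} (hφ : φ ∈ scaleTestFunctions) :
    (∫ x, x * deriv φ x ∂F) ^ 2 ≤ (fisherInfoScale F).toReal * ∫ x, φ x ^ 2 ∂F := by
  have h1 : ENNReal.ofReal ((∫ x, x * deriv φ x ∂F) ^ 2) / ENNReal.ofReal (∫ x, φ x ^ 2 ∂F) ≤
      fisherInfoScale F := by
    unfold fisherInfoScale
    exact le_iSup₂_of_le φ hφ le_rfl
  rw [ENNReal.div_le_iff_le_mul (Or.inr hF.ne) (Or.inl ENNReal.ofReal_ne_top),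
    ← ENNReal.ofReal_toReal hF.ne, ← ENNReal.ofReal_mul ENNReal.toReal_nonneg] at h1
  rwa [ENNReal.ofReal_le_ofReal_iff (by positivity)] at h1

/-- A linear functional on a vector space that is bounded by a seminorm pulled back from a Hilbert
space is represented by a vector of that space. -/
lemma exists_inner_eq_of_le_norm {V H : Type*} [AddCommGroup V] [Module ℝ V]
    [NormedAddCommGroup H] [InnerProductSpace ℝ H] [CompleteSpace H]
    (T : V →ₗ[ℝ] H) (l : V →ₗ[ℝ] ℝ) (C : ℝ) (hl : ∀ v, ‖l v‖ ≤ C * ‖T v‖) :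
    ∃ u : H, ∀ v, l v = inner ℝ u (T v) := by
  -- The bound gives `ker T ≤ ker l`, so `l` factors algebraically through `T`. The factor is
  -- continuous on the range of `T`, which need not be closed; Hahn-Banach extends it and Riesz
  -- represents it.
  have hmem : l ∈ T.dualMap.range := by
    rw [LinearMap.range_dualMap_eq_dualAnnihilator_ker, Submodule.mem_dualAnnihilator]
    intro v hv
    have := hl v
    rw [LinearMap.mem_ker.1 hv, norm_zero, mul_zero] at this
    exact norm_le_zero_iff.1 this
  obtain ⟨L, hL⟩ := hmem
  have hL' : ∀ v, L (T v) = l v := fun v => by rw [← hL]; rfl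
  let L₀ : StrongDual ℝ T.range := (L.comp T.range.subtype).mkContinuous C (by
    rintro ⟨_, v, rfl⟩
    simpa [hL'] using hl v)
  obtain ⟨g, hg, -⟩ := exists_extension_norm_eq T.range L₀
  refine ⟨(InnerProductSpace.toDual ℝ H).symm g, fun v => ?_⟩
  rw [InnerProductSpace.toDual_symm_apply]
  have := hg ⟨T v, v, rfl⟩
  rw [show g (T v) = _ from this, ← hL' v]
  rfl

lemma exists_dual_score (F : Measure ℝ) [IsFiniteMeasure F] (hF : fisherInfoScale F < ∞) :
    ∃ g : ℝ → ℝ, Measurable g ∧ MemLp g 2 F ∧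
      ∀ φ ∈ scaleTestFunctions, ∫ x, x * deriv φ x ∂F = -∫ x, φ x * g x ∂F := by
  let T : scaleTestSpace →ₗ[ℝ] Lp ℝ 2 F :=
    { toFun := fun φ => (scaleTestFunctions.memLp φ.2 F 2).toLp φ.1
      map_add' := fun φ ψ => MemLp.toLp_add _ _
      map_smul' := fun c φ => MemLp.toLp_const_smul c _ }
  let l : scaleTestSpace →ₗ[ℝ] ℝ :=
    { toFun := fun φ => ∫ x, x * deriv φ.1 x ∂F
      map_add' := fun φ ψ => by
        rw [← integral_add (scaleTestFunctions.integrable_mul_deriv φ.2 F)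
          (scaleTestFunctions.integrable_mul_deriv ψ.2 F)]
        refine integral_congr_ae (Eventually.of_forall fun x => ?_)
        have : deriv (φ.1 + ψ.1) x = deriv φ.1 x + deriv ψ.1 x := deriv_add (φ.2.1 x) (ψ.2.1 x)
        simp only [Submodule.coe_add, this]
        ring
      map_smul' := fun c φ => by
        rw [RingHom.id_apply, smul_eq_mul, ← integral_const_mul]
        refine integral_congr_ae (Eventually.of_forall fun x => ?_)
        have : deriv (c • φ.1) x = c • deriv φ.1 x := deriv_const_smul c (φ.2.1 x)
        simp only [Submodule.coe_smul, this, smul_eq_mul]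
        ring }
  have hinner : ∀ (u : Lp ℝ 2 F) (φ : scaleTestSpace),
      inner ℝ u (T φ) = ∫ x, φ.1 x * u x ∂F := by
    intro u φ
    rw [L2.inner_def]
    refine integral_congr_ae ?_
    filter_upwards [(scaleTestFunctions.memLp φ.2 F 2).coeFn_toLp] with x hx
    simp only [T, LinearMap.coe_mk, AddHom.coe_mk, hx]
    simp
  obtain ⟨u, hu⟩ := exists_inner_eq_of_le_norm T l √(fisherInfoScale F).toReal (by
    intro φ
    have h1 := sq_integral_mul_deriv_le F hF φ.2
    have h2 : ‖T φ‖ ^ 2 = ∫ x, φ.1 x ^ 2 ∂F := by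
      rw [← real_inner_self_eq_norm_sq, hinner]
      refine integral_congr_ae ?_
      filter_upwards [(scaleTestFunctions.memLp φ.2 F 2).coeFn_toLp] with x hx
      simp only [T, LinearMap.coe_mk, AddHom.coe_mk, hx]
      ring
    rw [← h2] at h1
    rw [← Real.sqrt_sq (norm_nonneg (T φ)), ← Real.sqrt_mul ENNReal.toReal_nonneg]
    exact Real.abs_le_sqrt h1)
  -- The sign is chosen so that `g f`, rather than `-g f`, becomes the derivative of `x f(x)`.
  refine ⟨fun x => -u x, (Lp.stronglyMeasurable u).measurable.neg, (Lp.memLp u).neg,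
    fun φ hφ => ?_⟩
  have := hu ⟨φ, hφ⟩
  rw [hinner] at this
  simp only [mul_neg, integral_neg, neg_neg]
  exact this

/-! ### Integration by parts, absolute continuity off the origin, and the atom. -/

lemma hasDerivAt_integral_Iic {ψ : ℝ → ℝ} (hψ : Continuous ψ) (hi : Integrable ψ) (x : ℝ) :
    HasDerivAt (fun x => ∫ y in Set.Iic x, ψ y) (ψ x) x := by
  have h1 : (fun x => ∫ y in Set.Iic x, ψ y) =
      fun x => (∫ y in Set.Iic (0 : ℝ), ψ y) + ∫ y in (0 : ℝ)..x, ψ y := by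
    ext x
    rw [← intervalIntegral.integral_Iic_sub_Iic hi.integrableOn hi.integrableOn]
    ring
  rw [h1]
  exact (intervalIntegral.integral_hasDerivAt_right (hψ.intervalIntegrable _ _)
    (hψ.stronglyMeasurableAtFilter _ _) hψ.continuousAt).const_add _

/-- Test functions need not vanish at infinity, so no condition `∫ ψ = 0` is needed; this is why `x
F(dx)` is identified exactly and not merely up to a constant density. -/
lemma integral_Iic_mem_scaleTestFunctions {ψ : ℝ → ℝ} (hψ : Continuous ψ)
    (hs : HasCompactSupport ψ) : (fun x => ∫ y in Set.Iic x, ψ y) ∈ scaleTestFunctions := by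
  have hd := hasDerivAt_integral_Iic hψ (hψ.integrable_of_hasCompactSupport hs)
  have : deriv (fun x => ∫ y in Set.Iic x, ψ y) = ψ := funext fun x => (hd x).deriv
  exact ⟨fun x => (hd x).differentiableAt, by rwa [this], by rwa [this]⟩

/-- Integration by parts: a dual score is the derivative of `x F(dx)`. -/
lemma integral_mul_eq_integral_mul_tail {F : Measure ℝ} [IsFiniteMeasure F] {g : ℝ → ℝ}
    (hg : Integrable g F)
    (hdual : ∀ φ ∈ scaleTestFunctions, ∫ x, x * deriv φ x ∂F = -∫ x, φ x * g x ∂F)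
    {ψ : ℝ → ℝ} (hψ : Continuous ψ) (hs : HasCompactSupport ψ) :
    ∫ x, x * ψ x ∂F = ∫ y, ψ y * -∫ x in Set.Ici y, g x ∂F := by
  have hi := hψ.integrable_of_hasCompactSupport (μ := volume) hs
  have h1 := hdual _ (integral_Iic_mem_scaleTestFunctions hψ hs)
  simp only [(hasDerivAt_integral_Iic hψ hi _).deriv] at h1
  rw [h1]
  -- Fubini on the half-plane `y ≤ x`; its closed boundary produces the closed tails `Set.Ici y`.
  set S : Set (ℝ × ℝ) := {p | p.2 ≤ p.1} with hS
  have hSm : MeasurableSet S := measurableSet_le measurable_snd measurable_fst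
  have hint : Integrable (S.indicator fun p : ℝ × ℝ => g p.1 * ψ p.2) (F.prod volume) :=
    (hg.mul_prod hi).indicator hSm
  have h2 : ∀ x, (∫ y in Set.Iic x, ψ y) * g x =
      ∫ y, S.indicator (fun p : ℝ × ℝ => g p.1 * ψ p.2) (x, y) := by
    intro x
    rw [← integral_mul_const, ← integral_indicator measurableSet_Iic]
    refine integral_congr_ae (Eventually.of_forall fun y => ?_)
    simp only [Set.indicator, hS, Set.mem_ofPred_eq, Set.mem_Iic]
    split_ifs <;> ring
  have h3 : ∀ y, ψ y * -∫ x in Set.Ici y, g x ∂F =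
      -∫ x, S.indicator (fun p : ℝ × ℝ => g p.1 * ψ p.2) (x, y) ∂F := by
    intro y
    rw [mul_neg, ← integral_const_mul, ← integral_indicator measurableSet_Ici]
    congr 1
    refine integral_congr_ae (Eventually.of_forall fun x => ?_)
    simp only [Set.indicator, hS, Set.mem_ofPred_eq, Set.mem_Ici]
    split_ifs <;> ring
  simp only [h2, h3]
  rw [integral_neg, integral_integral_swap (f := fun x y =>
    S.indicator (fun p : ℝ × ℝ => g p.1 * ψ p.2) (x, y)) hint]

lemma measurable_integral_Ici (F : Measure ℝ) [SFinite F] {g : ℝ → ℝ} (hg : Measurable g) :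
    Measurable fun y => ∫ x in Set.Ici y, g x ∂F := by
  have h : StronglyMeasurable ({p : ℝ × ℝ | p.1 ≤ p.2}.indicator fun p => g p.2) :=
    ((hg.comp measurable_snd).indicator
      (measurableSet_le measurable_fst measurable_snd)).stronglyMeasurable
  have h2 := h.integral_prod_right' (ν := F)
  convert h2.measurable using 1
  ext y
  rw [← integral_indicator measurableSet_Ici]
  rfl

lemma norm_setIntegral_le {α : Type*} [MeasurableSpace α] {F : Measure α} {g : α → ℝ}
    (hg : Integrable g F) (s : Set α) : ‖∫ x in s, g x ∂F‖ ≤ ∫ x, ‖g x‖ ∂F :=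
  (norm_integral_le_integral_norm _).trans
    (setIntegral_le_integral hg.norm (Eventually.of_forall fun _ => norm_nonneg _))

lemma isLocallyFiniteMeasure_withDensity_of_le {μ : Measure ℝ} [IsLocallyFiniteMeasure μ]
    {M : ℝ → ℝ} {C : ℝ} (hC : ∀ x, M x ≤ C) :
    IsLocallyFiniteMeasure (μ.withDensity fun x => ENNReal.ofReal (M x)) := by
  have hle : (μ.withDensity fun x => ENNReal.ofReal (M x)) ≤
      μ.withDensity fun _ => ENNReal.ofReal C :=
    withDensity_mono (Eventually.of_forall fun x => ENNReal.ofReal_le_ofReal (hC x))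
  have : IsLocallyFiniteMeasure (μ.withDensity fun _ : ℝ => ENNReal.ofReal C) :=
    IsLocallyFiniteMeasure.withDensity_ofReal continuous_const
  exact Measure.isLocallyFiniteMeasure_of_le hle

lemma isLocallyFiniteMeasure_add (μ ν : Measure ℝ) [IsLocallyFiniteMeasure μ]
    [IsLocallyFiniteMeasure ν] : IsLocallyFiniteMeasure (μ + ν) := by
  refine ⟨fun x => ?_⟩
  obtain ⟨s, hs, hμ⟩ := μ.finiteAt_nhds x
  obtain ⟨t, ht, hν⟩ := ν.finiteAt_nhds x
  refine ⟨s ∩ t, inter_mem hs ht, ?_⟩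
  rw [Measure.add_apply]
  exact ENNReal.add_lt_top.2 ⟨(measure_mono Set.inter_subset_left).trans_lt hμ,
    (measure_mono Set.inter_subset_right).trans_lt hν⟩

lemma integral_withDensity_ofReal {α : Type*} [MeasurableSpace α] (μ : Measure α) {w : α → ℝ}
    (hw : Measurable w) (ψ : α → ℝ) :
    ∫ x, ψ x ∂(μ.withDensity fun x => ENNReal.ofReal (w x)) = ∫ x, max (w x) 0 * ψ x ∂μ := by
  rw [integral_withDensity_eq_integral_toReal_smul (by fun_prop)
    (Eventually.of_forall fun _ => ENNReal.ofReal_lt_top)]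
  simp only [ENNReal.toReal_ofReal', smul_eq_mul]

/-- If `x F(dx)` has a bounded density as a signed Radon measure, then the punctured measure is
absolutely continuous. -/
lemma puncture_absolutelyContinuous_of_integral_eq {F : Measure ℝ} [IsFiniteMeasure F]
    {M : ℝ → ℝ} (hM : Measurable M) {C : ℝ} (hC : ∀ x, ‖M x‖ ≤ C)
    (h : ∀ ψ : ℝ → ℝ, Continuous ψ → HasCompactSupport ψ →
      ∫ x, x * ψ x ∂F = ∫ y, ψ y * M y) : puncture F ≪ volume := by
  set F₁ := F.withDensity fun x => ENNReal.ofReal x with hF₁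
  set F₂ := F.withDensity fun x => ENNReal.ofReal (-x) with hF₂
  set V₁ := (volume : Measure ℝ).withDensity fun x => ENNReal.ofReal (M x) with hV₁
  set V₂ := (volume : Measure ℝ).withDensity fun x => ENNReal.ofReal (-M x) with hV₂
  have : IsLocallyFiniteMeasure F₁ := IsLocallyFiniteMeasure.withDensity_ofReal continuous_id
  have : IsLocallyFiniteMeasure F₂ := IsLocallyFiniteMeasure.withDensity_ofReal continuous_neg
  have : IsLocallyFiniteMeasure V₁ :=
    isLocallyFiniteMeasure_withDensity_of_le fun x => (le_abs_self _).trans (hC x)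
  have : IsLocallyFiniteMeasure V₂ :=
    isLocallyFiniteMeasure_withDensity_of_le fun x => (neg_le_abs _).trans (hC x)
  have hmax : ∀ x : ℝ, max x 0 = x + max (-x) 0 := by
    intro x
    rcases le_total x 0 with hx | hx
    · rw [max_eq_right hx, max_eq_left (by linarith)]; ring
    · rw [max_eq_left hx, max_eq_right (by linarith)]; ring
  -- The signed identity `F₁ - F₂ = V₁ - V₂` is rearranged into one between positive locally finite
  -- measures, which are determined by their integrals of compactly supported continuous functions.
  have heq : F₁ + V₂ = F₂ + V₁ := by
    have := isLocallyFiniteMeasure_add F₁ V₂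
    have := isLocallyFiniteMeasure_add F₂ V₁
    refine Measure.ext_of_integral_eq_on_compactlySupported fun ψ => ?_
    have hψc := ψ.continuous
    have hψs := ψ.hasCompactSupport
    have hψi : ∀ (μ : Measure ℝ) [IsLocallyFiniteMeasure μ], Integrable ψ μ :=
      fun μ _ => hψc.integrable_of_hasCompactSupport hψs
    rw [integral_add_measure (hψi _) (hψi _), integral_add_measure (hψi _) (hψi _)]
    have e1 : ∫ x, ψ x ∂F₁ = ∫ x, x * ψ x ∂F + ∫ x, ψ x ∂F₂ := by
      rw [hF₁, hF₂, integral_withDensity_ofReal F (w := fun x => x) measurable_id,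
        integral_withDensity_ofReal F (w := fun x => -x) measurable_neg, ← integral_add]
      · refine integral_congr_ae (Eventually.of_forall fun x => ?_)
        simp only
        rw [hmax x]; ring
      · exact (continuous_id.mul hψc).integrable_of_hasCompactSupport hψs.mul_left
      · exact ((continuous_neg.max continuous_const).mul hψc).integrable_of_hasCompactSupport
          hψs.mul_left
    have e2 : ∫ x, ψ x ∂V₁ = (∫ x, ψ x * M x) + ∫ x, ψ x ∂V₂ := by
      have hb : ∀ N : ℝ → ℝ, Measurable N → (∀ x, ‖N x‖ ≤ C) →
          Integrable fun x => N x * ψ x := fun N hN hNC =>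
        (hψi volume).bdd_mul hN.aestronglyMeasurable (Eventually.of_forall hNC)
      rw [hV₁, hV₂, integral_withDensity_ofReal _ hM,
        integral_withDensity_ofReal _ (w := fun x => -M x) hM.neg, ← integral_add]
      · refine integral_congr_ae (Eventually.of_forall fun x => ?_)
        simp only
        rw [hmax (M x)]; ring
      · simpa only [mul_comm] using hb M hM hC
      · refine hb _ (hM.neg.max measurable_const) fun x => ?_
        rw [Real.norm_of_nonneg (le_max_right _ _)]
        exact max_le ((neg_le_abs _).trans (hC x)) ((norm_nonneg _).trans (hC x))
    rw [e1, e2, h ψ hψc hψs]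
    ring
  have hnull : ∀ A : Set ℝ, MeasurableSet A → volume A = 0 → F₁ A = F₂ A := by
    intro A hA hA0
    have := congrArg (fun μ : Measure ℝ => μ A) heq
    simpa [hV₁, hV₂, withDensity_absolutelyContinuous _ _ hA0] using this
  refine Measure.AbsolutelyContinuous.mk fun A hA hA0 => ?_
  -- On each open half-line one of `F₁`, `F₂` vanishes, so their equality on Lebesgue null sets
  -- makes both vanish there, and the positive weight can be removed.
  have hside : ∀ (w : ℝ → ℝ) (B : Set ℝ), Measurable w → MeasurableSet B → (∀ x ∈ B, 0 < w x) →
      (F.withDensity fun x => ENNReal.ofReal (w x)) (A ∩ B) =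
        (F.withDensity fun x => ENNReal.ofReal (-w x)) (A ∩ B) → F (A ∩ B) = 0 := by
    intro w B hw hB hpos he
    have hz : (F.withDensity fun x => ENNReal.ofReal (-w x)) (A ∩ B) = 0 := by
      rw [withDensity_apply _ (hA.inter hB)]
      rw [setLIntegral_congr_fun (hA.inter hB) (g := fun _ => 0)]
      · simp
      · intro x hx
        exact ENNReal.ofReal_eq_zero.2 (by linarith [hpos x hx.2])
    rw [hz, withDensity_apply_eq_zero (by fun_prop)] at he
    refine measure_mono_null (fun x hx => Set.mem_inter ?_ hx) he
    simpa using hpos x hx.2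
  have hp : F (A ∩ Set.Ioi 0) = 0 :=
    hside (fun x => x) _ measurable_id measurableSet_Ioi (fun x hx => hx)
      (hnull _ (hA.inter measurableSet_Ioi) (measure_mono_null Set.inter_subset_left hA0))
  have hn : F (A ∩ Set.Iio 0) = 0 := by
    refine hside (fun x => -x) _ measurable_neg measurableSet_Iio (fun x hx => neg_pos.2 hx) ?_
    simp only [neg_neg]
    exact (hnull _ (hA.inter measurableSet_Iio)
      (measure_mono_null Set.inter_subset_left hA0)).symm
  rw [puncture, Measure.restrict_apply hA]
  refine measure_mono_null (fun x hx => ?_) (measure_union_null hp hn)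
  rcases lt_or_gt_of_ne (show x ≠ 0 from hx.2) with h0 | h0
  · exact Or.inr ⟨hx.1, h0⟩
  · exact Or.inl ⟨hx.1, h0⟩

/-- A dual score does not charge the atom at zero. -/
lemma integral_singleton_zero_of_dual {F : Measure ℝ} [IsFiniteMeasure F] {g : ℝ → ℝ}
    (hg : Integrable g F)
    (hdual : ∀ φ ∈ scaleTestFunctions, ∫ x, x * deriv φ x ∂F = -∫ x, φ x * g x ∂F) :
    ∫ x in {0}, g x ∂F = 0 := by
  let η : ContDiffBump (0 : ℝ) := ⟨1, 2, by norm_num, by norm_num⟩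
  have hη : ContDiff ℝ 1 η := η.contDiff
  have hηd : Differentiable ℝ η := hη.differentiable (by norm_num)
  have hηc : Continuous (deriv η) := hη.continuous_deriv le_rfl
  have hηs : HasCompactSupport (deriv η) := η.hasCompactSupport.deriv
  set c : ℕ → ℝ := fun n => (n : ℝ) + 1 with hc
  have hcpos : ∀ n, 0 < c n := fun n => by positivity
  -- These shrink to the indicator of `{0}`, while `x φₙ'(x) = u η'(u)` at `u = c n * x` stays
  -- bounded and tends to `0` pointwise. Dominated convergence applies to both sides of the duality.
  set φ : ℕ → ℝ → ℝ := fun n x => η (c n * x) with hφ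
  have hφd : ∀ n x, HasDerivAt (φ n) (c n * deriv η (c n * x)) x := by
    intro n x
    have h1 : HasDerivAt (fun x => c n * x) (c n) x := by
      simpa using (hasDerivAt_id x).const_mul (c n)
    have := (hηd (c n * x)).hasDerivAt.comp x h1
    rw [mul_comm]
    exact this
  have hφ' : ∀ n, deriv (φ n) = fun x => c n * deriv η (c n * x) :=
    fun n => funext fun x => (hφd n x).deriv
  have hφt : ∀ n, φ n ∈ scaleTestFunctions := by
    intro n
    refine ⟨fun x => (hφd n x).differentiableAt, ?_, ?_⟩
    · rw [hφ' n]; fun_prop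
    · rw [hφ' n]
      exact (hηs.comp_homeomorph (Homeomorph.mulLeft₀ (c n) (hcpos n).ne')).mul_left
  have hlarge : ∀ x : ℝ, x ≠ 0 → ∀ᶠ n in atTop, 2 < |c n * x| := by
    intro x hx
    have : Tendsto (fun n => |c n * x|) atTop atTop := by
      simp only [abs_mul]
      refine Tendsto.atTop_mul_const (abs_pos.2 hx) ?_
      exact tendsto_abs_atTop_atTop.comp
        (tendsto_atTop_add_const_right _ _ tendsto_natCast_atTop_atTop)
    exact this.eventually_gt_atTop 2
  have hη0 : ∀ u : ℝ, 2 < |u| → η u = 0 ∧ deriv η u = 0 := by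
    intro u hu
    have hz : ∀ v : ℝ, 2 < |v| → η v = 0 := fun v hv =>
      η.zero_of_le_dist (by simpa using hv.le)
    refine ⟨hz u hu, ?_⟩
    have hev : η =ᶠ[𝓝 u] fun _ => 0 := by
      filter_upwards [(continuous_abs.tendsto u).eventually (lt_mem_nhds hu)] with v hv
      exact hz v hv
    rw [hev.deriv_eq, deriv_const]
  have hηb : ∀ u, ‖η u‖ ≤ 1 := fun u => by
    rw [Real.norm_of_nonneg η.nonneg]; exact η.le_one
  obtain ⟨C, hC⟩ : ∃ C, ∀ u : ℝ, ‖u * deriv η u‖ ≤ C :=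
    (continuous_id.mul hηc).bounded_above_of_compact_support hηs.mul_left
  have hL : Tendsto (fun n => ∫ x, x * deriv (φ n) x ∂F) atTop (𝓝 0) := by
    rw [← integral_zero ℝ ℝ (μ := F)]
    refine tendsto_integral_of_dominated_convergence (fun _ => C) (fun n => ?_)
      (integrable_const C) (fun n => ?_) ?_
    · exact (scaleTestFunctions.integrable_mul_deriv (hφt n) F).aestronglyMeasurable
    · refine Eventually.of_forall fun x => ?_
      rw [hφ' n]
      have := hC (c n * x)
      rwa [mul_comm (c n) x, mul_assoc, mul_comm x (c n)] at this
    · refine Eventually.of_forall fun x => ?_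
      by_cases hx : x = 0
      · simp [hx]
      · refine tendsto_const_nhds.congr' ?_
        filter_upwards [hlarge x hx] with n hn
        simp [hφ' n, (hη0 _ hn).2]
  have hR : Tendsto (fun n => ∫ x, φ n x * g x ∂F) atTop (𝓝 (∫ x in {0}, g x ∂F)) := by
    rw [← integral_indicator (measurableSet_singleton 0)]
    refine tendsto_integral_of_dominated_convergence (fun x => ‖g x‖) (fun n => ?_)
      hg.norm (fun n => ?_) ?_
    · exact (hφt n).1.continuous.aestronglyMeasurable.mul hg.aestronglyMeasurable
    · refine Eventually.of_forall fun x => ?_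
      rw [norm_mul]
      exact mul_le_of_le_one_left (norm_nonneg _) (hηb _)
    · refine Eventually.of_forall fun x => ?_
      by_cases hx : x = 0
      · have : η 0 = 1 := η.one_of_mem_closedBall (by simp [η])
        simp [hx, hφ, this]
      · refine tendsto_const_nhds.congr' ?_
        filter_upwards [hlarge x hx] with n hn
        simp [hφ, (hη0 _ hn).1, hx]
  have h := tendsto_nhds_unique (hL.congr fun n => hdual _ (hφt n)) hR.neg
  linarith

/-! ### Increments of the square root of an absolutely continuous function. -/

lemma LipschitzOnWith.comp_absolutelyContinuousOnInterval {G m : ℝ → ℝ} {K : NNReal} {s : Set ℝ}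
    {a b : ℝ} (hG : LipschitzOnWith K G s) (hm : AbsolutelyContinuousOnInterval m a b)
    (hs : Set.MapsTo m (Set.uIcc a b) s) :
    AbsolutelyContinuousOnInterval (fun x => G (m x)) a b := by
  rw [absolutelyContinuousOnInterval_iff] at hm ⊢
  intro ε hε
  obtain ⟨δ, hδ, h⟩ := hm (ε / (K + 1)) (by positivity)
  refine ⟨δ, hδ, fun E hE hEδ => ?_⟩
  have h1 := h E hE hEδ
  have hE' : ∀ i ∈ Finset.range E.1, (E.2 i).1 ∈ Set.uIcc a b ∧ (E.2 i).2 ∈ Set.uIcc a b := hE.1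
  calc ∑ i ∈ Finset.range E.1, dist (G (m (E.2 i).1)) (G (m (E.2 i).2))
      ≤ ∑ i ∈ Finset.range E.1, K * dist (m (E.2 i).1) (m (E.2 i).2) :=
        Finset.sum_le_sum fun i hi =>
          hG.dist_le_mul _ (hs (hE' i hi).1) _ (hs (hE' i hi).2)
    _ = K * ∑ i ∈ Finset.range E.1, dist (m (E.2 i).1) (m (E.2 i).2) := by rw [Finset.mul_sum]
    _ ≤ K * (ε / (K + 1)) := by gcongr
    _ < (K + 1) * (ε / (K + 1)) := by
        apply mul_lt_mul_of_pos_right _ (by positivity)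
        linarith
    _ = ε := by field_simp

lemma lipschitzOnWith_sqrt_add {ε : ℝ} (hε : 0 < ε) :
    LipschitzOnWith (Real.toNNReal (1 / √ε)) (fun y => √(y + ε)) (Set.Ici 0) := by
  refine LipschitzOnWith.of_dist_le_mul fun x hx y hy => ?_
  simp only [Set.mem_Ici] at hx hy
  rw [Real.coe_toNNReal _ (by positivity), Real.dist_eq, Real.dist_eq, div_mul_eq_mul_div, one_mul,
    le_div_iff₀ (by positivity)]
  have h1 : x - y = (√(x + ε) - √(y + ε)) * (√(x + ε) + √(y + ε)) := by
    have := Real.sq_sqrt (show 0 ≤ x + ε by linarith)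
    have := Real.sq_sqrt (show 0 ≤ y + ε by linarith)
    linarith [show (√(x + ε) - √(y + ε)) * (√(x + ε) + √(y + ε)) =
      √(x + ε) ^ 2 - √(y + ε) ^ 2 by ring]
  rw [h1, abs_mul]
  gcongr
  rw [abs_of_nonneg (by positivity)]
  have : √ε ≤ √(x + ε) := Real.sqrt_le_sqrt (by linarith)
  linarith [Real.sqrt_nonneg (y + ε)]

/-- The increment of the square root of a nonnegative absolutely continuous function is controlled
by the integral of its formal derivative. -/
lemma enorm_sqrt_sub_sqrt_le {m h : ℝ → ℝ} {a b : ℝ} (hab : a ≤ b)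
    (hac : AbsolutelyContinuousOnInterval m a b) (hnn : ∀ x ∈ Set.Icc a b, 0 ≤ m x)
    (hderiv : ∀ᵐ x, x ∈ Set.Icc a b → HasDerivAt m (h x) x)
    (hzero : ∀ x ∈ Set.Icc a b, m x = 0 → h x = 0) :
    ‖√(m b) - √(m a)‖ₑ ≤ ∫⁻ x in Set.Icc a b, ‖h x / (2 * √(m x))‖ₑ := by
  -- The square root is not Lipschitz at `0`, so `m` is shifted by `ε`. The shifted derivative is
  -- dominated by the unshifted one where `m > 0`, and both are `0` where `m = 0` because `h`
  -- vanishes there.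
  have key : ∀ ε : ℝ, 0 < ε →
      ‖√(m b + ε) - √(m a + ε)‖ₑ ≤ ∫⁻ x in Set.Icc a b, ‖h x / (2 * √(m x))‖ₑ := by
    intro ε hε
    have hac' : AbsolutelyContinuousOnInterval (fun x => √(m x + ε)) a b :=
      (lipschitzOnWith_sqrt_add hε).comp_absolutelyContinuousOnInterval hac (by
        rw [Set.uIcc_of_le hab]; exact hnn)
    rw [← hac'.integral_deriv_eq_sub, intervalIntegral.integral_of_le hab,
      ← integral_Icc_eq_integral_Ioc]
    refine (enorm_integral_le_lintegral_enorm _).trans (lintegral_mono_ae ?_)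
    refine (ae_restrict_iff' measurableSet_Icc).2 ?_
    filter_upwards [hderiv] with x hx hxI
    have hm0 := hnn x hxI
    have hd : HasDerivAt (fun x => √(m x + ε)) (h x / (2 * √(m x + ε))) x :=
      ((hx hxI).add_const ε).sqrt (by positivity)
    rw [hd.deriv]
    rcases hm0.eq_or_lt with h0 | h0
    · simp [hzero x hxI h0.symm]
    · rw [← ofReal_norm, ← ofReal_norm, norm_div, norm_div]
      refine ENNReal.ofReal_le_ofReal ?_
      have h1 : √(m x) ≤ √(m x + ε) := Real.sqrt_le_sqrt (by linarith)
      have h2 : 0 < √(m x) := Real.sqrt_pos.2 h0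
      rw [Real.norm_of_nonneg (show 0 ≤ 2 * √(m x + ε) by positivity),
        Real.norm_of_nonneg (show 0 ≤ 2 * √(m x) by positivity)]
      gcongr
  have hlim : Tendsto (fun ε : ℝ => ‖√(m b + ε) - √(m a + ε)‖ₑ) (𝓝[>] 0)
      (𝓝 ‖√(m b) - √(m a)‖ₑ) := by
    have hc : Continuous fun ε : ℝ => ‖√(m b + ε) - √(m a + ε)‖ₑ := by fun_prop
    have := hc.tendsto 0
    simp only [add_zero] at this
    exact this.mono_left nhdsWithin_le_nhds
  exact le_of_tendsto hlim (eventually_mem_nhdsWithin.mono fun ε hε => key ε hε)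

lemma lintegral_Icc_inv_sq {a b : ℝ} (ha : 0 < a) (hab : a ≤ b) :
    ∫⁻ x in Set.Icc a b, ENNReal.ofReal (1 / x ^ 2) = ENNReal.ofReal (1 / a - 1 / b) := by
  have hne : ∀ x ∈ Set.uIcc a b, x ≠ 0 := by
    rw [Set.uIcc_of_le hab]
    exact fun x hx => (ha.trans_le hx.1).ne'
  have hcont : ContinuousOn (fun x : ℝ => 1 / x ^ 2) (Set.uIcc a b) :=
    continuousOn_const.div (continuousOn_id.pow 2) fun x hx => pow_ne_zero 2 (hne x hx)
  have h1 : ∫ x in a..b, 1 / x ^ 2 = 1 / a - 1 / b := by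
    rw [intervalIntegral.integral_eq_sub_of_hasDerivAt (f := fun x => -(1 / x))
      (fun x hx => ?_) hcont.intervalIntegrable]
    · ring
    · simpa only [one_div, neg_neg] using (hasDerivAt_inv (hne x hx)).fun_neg
  rw [← h1, intervalIntegral.integral_of_le hab, ← integral_Icc_eq_integral_Ioc,
    ofReal_integral_eq_lintegral_ofReal]
  · rw [Set.uIcc_of_le hab] at hcont
    exact hcont.integrableOn_compact isCompact_Icc
  · exact Eventually.of_forall fun x => by positivity

/-- Cauchy-Schwarz inequality with the weight `x⁻²`. -/
lemma sq_lintegral_Icc_le {k : ℝ → ℝ} (hk : Measurable k) {a b : ℝ} (ha : 0 < a) (hab : a ≤ b) :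
    (∫⁻ x in Set.Icc a b, ‖k x‖ₑ) ^ 2 ≤
      ENNReal.ofReal (1 / a - 1 / b) * ∫⁻ x in Set.Icc a b, ENNReal.ofReal (x ^ 2 * k x ^ 2) := by
  have h1 : ∫⁻ x in Set.Icc a b, ‖k x‖ₑ =
      ∫⁻ x in Set.Icc a b, ((fun x : ℝ => ‖1 / x‖ₑ) * fun x : ℝ => ‖x * k x‖ₑ) x := by
    refine setLIntegral_congr_fun measurableSet_Icc fun x hx => ?_
    have hx0 : x ≠ 0 := (ha.trans_le hx.1).ne'
    simp only [Pi.mul_apply, ← enorm_mul]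
    congr 1
    field_simp
  have h2 := ENNReal.lintegral_mul_le_Lp_mul_Lq (volume.restrict (Set.Icc a b))
    Real.HolderConjugate.two_two (f := fun x => ‖1 / x‖ₑ) (g := fun x => ‖x * k x‖ₑ)
    (by fun_prop) (by fun_prop)
  rw [← h1] at h2
  have hsq : ∀ y : ℝ, ‖y‖ₑ ^ (2 : ℝ) = ENNReal.ofReal (y ^ 2) := by
    intro y
    rw [ENNReal.rpow_two, ← ofReal_norm, ← ENNReal.ofReal_pow (norm_nonneg _),
      Real.norm_eq_abs, sq_abs]
  simp only [hsq] at h2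
  calc (∫⁻ x in Set.Icc a b, ‖k x‖ₑ) ^ 2 ≤ _ := pow_le_pow_left' h2 2
    _ = _ := by
      rw [mul_pow, ← ENNReal.rpow_two, ← ENNReal.rpow_two, ← ENNReal.rpow_mul, ← ENNReal.rpow_mul]
      simp only [one_div, inv_mul_cancel₀ (two_ne_zero (α := ℝ)), ENNReal.rpow_one, inv_pow]
      rw [← one_div, ← one_div, ← lintegral_Icc_inv_sq ha hab]
      simp only [mul_pow, one_div]

/-- With `k = h / (2√m)`, the increment is at most `∫ |k|` over `[x/t, x/s]`, and Cauchy-Schwarz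
with weight `y⁻²` bounds its square by `(t - s)/x · ∫ y² k²`. Tonelli then fixes `y` and lets `x`
range over `[sy, ty]`, where `∫ x⁻² dx = (t - s)/(s t y)`. This leaves `(t - s)²/(st) · ∫ y k²`. The
weight is what makes the constant sharp as `t - s → 0`. -/
lemma lintegral_Ioi_sq_sqrt_sub_sqrt_le {m h : ℝ → ℝ} (hhm : Measurable h) (hmm : Measurable m)
    (hac : ∀ a b, AbsolutelyContinuousOnInterval m a b)
    (hderiv : ∀ᵐ x, HasDerivAt m (h x) x) (hnn : ∀ x, 0 < x → 0 ≤ m x)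
    (hzero : ∀ x, 0 < x → m x = 0 → h x = 0) {s t : ℝ} (hs : 0 < s) (hst : s ≤ t) :
    ∫⁻ x in Set.Ioi 0, ENNReal.ofReal ((√(m (x / s)) - √(m (x / t))) ^ 2 / x) ≤
      ENNReal.ofReal ((t - s) ^ 2 / (s * t)) *
        ∫⁻ y in Set.Ioi 0, ENNReal.ofReal (y * h y ^ 2 / (4 * m y)) := by
  have ht : 0 < t := hs.trans_le hst
  set k : ℝ → ℝ := fun y => h y / (2 * √(m y)) with hk
  have hkm : Measurable k := by fun_prop
  set A : Set (ℝ × ℝ) := {p | 0 < p.1 ∧ p.1 / t ≤ p.2 ∧ p.2 ≤ p.1 / s} with hA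
  have hAm : MeasurableSet A := by
    refine (measurableSet_lt measurable_const measurable_fst).inter
      ((measurableSet_le (measurable_fst.div_const t) measurable_snd).inter
        (measurableSet_le measurable_snd (measurable_fst.div_const s)))
  set Φ : ℝ × ℝ → ℝ≥0∞ := A.indicator fun p =>
    ENNReal.ofReal ((t - s) * (1 / p.1 ^ 2)) * ENNReal.ofReal (p.2 ^ 2 * k p.2 ^ 2) with hΦ
  have hΦm : Measurable Φ := by
    refine Measurable.indicator ?_ hAm
    fun_prop
  have hx : ∀ x ∈ Set.Ioi (0 : ℝ),
      ENNReal.ofReal ((√(m (x / s)) - √(m (x / t))) ^ 2 / x) ≤ ∫⁻ y, Φ (x, y) := by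
    intro x hx
    have hx : 0 < x := hx
    have hle : x / t ≤ x / s := by gcongr
    have h0 : 0 < x / t := by positivity
    have h1 := enorm_sqrt_sub_sqrt_le hle (hac _ _)
      (fun y hy => hnn y (h0.trans_le hy.1)) (hderiv.mono fun _ h _ => h)
      (fun y hy => hzero y (h0.trans_le hy.1))
    have h2 := (pow_le_pow_left' h1 2).trans (sq_lintegral_Icc_le hkm h0 hle)
    have h3 : ∀ y, Φ (x, y) = (Set.Icc (x / t) (x / s)).indicator
        (fun y => ENNReal.ofReal ((t - s) * (1 / x ^ 2)) * ENNReal.ofReal (y ^ 2 * k y ^ 2)) y := by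
      intro y
      simp only [hΦ, hA, Set.indicator, Set.mem_ofPred_eq, Set.mem_Icc, hx, true_and]
    rw [lintegral_congr h3, lintegral_indicator measurableSet_Icc, lintegral_const_mul _
      (by fun_prop), div_eq_mul_inv, ENNReal.ofReal_mul (by positivity)]
    have h4 : ENNReal.ofReal ((√(m (x / s)) - √(m (x / t))) ^ 2) =
        ‖√(m (x / s)) - √(m (x / t))‖ₑ ^ 2 := by
      rw [← ofReal_norm, ← ENNReal.ofReal_pow (norm_nonneg _), Real.norm_eq_abs, sq_abs]
    rw [h4]
    calc _ ≤ _ := mul_le_mul_left h2 _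
      _ = _ := by
        rw [mul_right_comm, ← ENNReal.ofReal_mul']
        · congr 2
          field_simp
        · positivity
  have hy : ∀ y, ∫⁻ x in Set.Ioi 0, Φ (x, y) ≤ (Set.Ioi (0 : ℝ)).indicator (fun y =>
      ENNReal.ofReal ((t - s) ^ 2 / (s * t)) * ENNReal.ofReal (y * h y ^ 2 / (4 * m y))) y := by
    intro y
    by_cases hy0 : 0 < y
    · rw [Set.indicator_of_mem (Set.mem_Ioi.2 hy0)]
      have h3 : ∀ x, Φ (x, y) = (Set.Icc (s * y) (t * y)).indicator
          (fun x => ENNReal.ofReal (y ^ 2 * k y ^ 2) * ENNReal.ofReal (t - s) *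
            ENNReal.ofReal (1 / x ^ 2)) x := by
        intro x
        have hiff : (x, y) ∈ A ↔ x ∈ Set.Icc (s * y) (t * y) := by
          simp only [hA, Set.mem_ofPred_eq, Set.mem_Icc]
          rw [div_le_iff₀ ht, le_div_iff₀ hs]
          constructor
          · rintro ⟨-, h1, h2⟩
            exact ⟨by linarith, by linarith⟩
          · rintro ⟨h1, h2⟩
            exact ⟨(mul_pos hs hy0).trans_le h1, by linarith, by linarith⟩
        simp only [hΦ, Set.indicator, hiff]
        split_ifs
        · rw [ENNReal.ofReal_mul (by linarith)]
          ring
        · rfl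
      refine (setLIntegral_le_lintegral _ _).trans ?_
      rw [lintegral_congr h3, lintegral_indicator measurableSet_Icc, lintegral_const_mul _
        (by fun_prop), lintegral_Icc_inv_sq (by positivity) (by gcongr),
        ← ENNReal.ofReal_mul (by positivity), ← ENNReal.ofReal_mul (by
          apply mul_nonneg (by positivity); linarith), ← ENNReal.ofReal_mul (by positivity)]
      refine ENNReal.ofReal_le_ofReal (le_of_eq ?_)
      rw [hk]
      simp only [div_pow, mul_pow, Real.sq_sqrt (hnn y hy0)]
      by_cases hm0 : m y = 0
      · simp [hm0]
      · field_simp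
        ring
    · rw [Set.indicator_of_notMem (by simpa using hy0), nonpos_iff_eq_zero]
      rw [← lintegral_zero (μ := volume.restrict (Set.Ioi (0 : ℝ)))]
      refine setLIntegral_congr_fun measurableSet_Ioi fun x hx => ?_
      refine Set.indicator_of_notMem ?_ _
      rintro ⟨h1, h2, -⟩
      exact hy0 ((div_pos h1 ht).trans_le h2)
  calc _ ≤ ∫⁻ x in Set.Ioi 0, ∫⁻ y, Φ (x, y) := setLIntegral_mono' measurableSet_Ioi hx
    _ = ∫⁻ y, ∫⁻ x in Set.Ioi 0, Φ (x, y) := lintegral_lintegral_swap (by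
        exact hΦm.aemeasurable)
    _ ≤ _ := lintegral_mono hy
    _ = _ := by rw [lintegral_indicator measurableSet_Ioi, lintegral_const_mul _ (by fun_prop)]

/-! ### A criterion for strong convergence in `L₂`. -/

/-- Almost everywhere convergence on the support of the limit, together with an asymptotic bound on
the `L₂` norms by that of the limit, implies convergence in `L₂`. -/
lemma tendsto_lintegral_sq_sub_of_le {α ι : Type*} [MeasurableSpace α] {μ : Measure α}
    {l : Filter ι} [l.IsCountablyGenerated] {u : ι → α → ℝ} {v : α → ℝ} {c : ι → ℝ≥0∞}
    (hu : ∀ i, Measurable (u i)) (hv : Measurable v)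
    (hfin : ∫⁻ x, ENNReal.ofReal (v x ^ 2) ∂μ ≠ ∞)
    (hle : ∀ᶠ i in l, ∫⁻ x, ENNReal.ofReal (u i x ^ 2) ∂μ ≤ c i)
    (hc : Tendsto c l (𝓝 (∫⁻ x, ENNReal.ofReal (v x ^ 2) ∂μ)))
    (hlim : ∀ᵐ x ∂μ, v x ≠ 0 → Tendsto (fun i => u i x) l (𝓝 (v x))) :
    Tendsto (fun i => ∫⁻ x, ENNReal.ofReal ((u i x - v x) ^ 2) ∂μ) l (𝓝 0) := by
  rcases eq_or_neBot l with rfl | hl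
  · exact tendsto_bot
  set B := ∫⁻ x, ENNReal.ofReal (v x ^ 2) ∂μ with hB
  set P : ι → ℝ≥0∞ := fun i => ∫⁻ x, ENNReal.ofReal ((u i x + v x) ^ 2) ∂μ with hP
  set N : ι → ℝ≥0∞ := fun i => ∫⁻ x, ENNReal.ofReal ((u i x - v x) ^ 2) ∂μ with hN
  -- Parallelogram identity: an upper bound on `N` follows from a lower bound on `P`, which Fatou
  -- supplies. Where `v = 0` the lower bound is trivial, so no pointwise convergence is needed
  -- there.
  have hsum : ∀ i, N i + P i = 2 * ∫⁻ x, ENNReal.ofReal (u i x ^ 2) ∂μ + 2 * B := by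
    intro i
    rw [hN, hP, hB, ← lintegral_const_mul _ (by fun_prop), ← lintegral_const_mul _ (by fun_prop),
      ← lintegral_add_left (by fun_prop), ← lintegral_add_left (by fun_prop)]
    refine lintegral_congr fun x => ?_
    rw [← ENNReal.ofReal_add (by positivity) (by positivity),
      show (2 : ℝ≥0∞) = ENNReal.ofReal 2 by simp,
      ← ENNReal.ofReal_mul (by norm_num), ← ENNReal.ofReal_mul (by norm_num),
      ← ENNReal.ofReal_add (by positivity) (by positivity)]
    congr 1
    ring
  have hfatou : 4 * B ≤ liminf P l := by
    refine le_trans ?_ (lintegral_liminf_le fun i => by fun_prop)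
    rw [hB, ← lintegral_const_mul _ (by fun_prop)]
    refine lintegral_mono_ae ?_
    filter_upwards [hlim] with x hx
    by_cases hv0 : v x = 0
    · simp [hv0]
    · have : Tendsto (fun i => ENNReal.ofReal ((u i x + v x) ^ 2)) l
          (𝓝 (ENNReal.ofReal ((v x + v x) ^ 2))) :=
        ENNReal.tendsto_ofReal (((hx hv0).add_const _).pow 2)
      rw [this.liminf_eq, show (4 : ℝ≥0∞) = ENNReal.ofReal 4 by simp,
        ← ENNReal.ofReal_mul (by norm_num)]
      exact le_of_eq (by congr 1; ring)
  rw [ENNReal.tendsto_nhds_zero]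
  intro ε hε
  rcases eq_or_ne ε ∞ with rfl | hε'
  · exact Eventually.of_forall fun _ => le_top
  have hcε : ∀ᶠ i in l, c i ≤ B + ε / 4 := by
    have : B < B + ε / 4 := ENNReal.lt_add_right hfin (by simp [hε.ne'])
    exact (hc.eventually (gt_mem_nhds this)).mono fun _ h => h.le
  have hPε : ∀ᶠ i in l, 4 * B ≤ P i + ε / 2 := by
    -- Strictness of `4 * B - ε / 2 < 4 * B` fails in `ℝ≥0∞` when `B = 0`, hence the split.
    rcases le_or_gt (4 * B) (ε / 2) with h | h
    · exact Eventually.of_forall fun i => h.trans le_add_self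
    · have h4 : 4 * B - ε / 2 < 4 * B :=
        ENNReal.sub_lt_self (ENNReal.mul_ne_top (by simp) hfin)
          (by intro h0; rw [h0] at h; simp at h) (by simp [hε.ne'])
      filter_upwards [eventually_lt_of_lt_liminf (h4.trans_le hfatou)] with i hi
      exact tsub_le_iff_right.1 hi.le
  clear hB hP hN hc
  clear_value N P B
  filter_upwards [hle, hcε, hPε] with i h1 h2 h3
  have h5 : N i + 4 * B ≤ ε + 4 * B := by
    calc N i + 4 * B ≤ N i + (P i + ε / 2) := by gcongr
      _ = 2 * ∫⁻ x, ENNReal.ofReal (u i x ^ 2) ∂μ + 2 * B + ε / 2 := by rw [← add_assoc, hsum]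
      _ ≤ 2 * (B + ε / 4) + 2 * B + ε / 2 := by gcongr; exact h1.trans h2
      _ = ε + 4 * B := by
        lift ε to NNReal using hε'
        lift B to NNReal using hfin
        have : ((4 : NNReal) : ℝ≥0∞) = 4 := by simp
        rw [show (2 : ℝ≥0∞) = ((2 : NNReal) : ℝ≥0∞) by simp, ← this,
          ← ENNReal.coe_div (by norm_num), ← ENNReal.coe_div (by norm_num)]
        norm_cast
        apply NNReal.eq
        push_cast
        ring
  exact (ENNReal.add_le_add_iff_right (ENNReal.mul_ne_top (by simp) hfin)).1 h5

/-! ### Indefinite integrals and the construction of the density. -/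

lemma absolutelyContinuousOnLine_of_integral {m h : ℝ → ℝ} (hh : Integrable h)
    (hm : ∀ a b, m b - m a = ∫ x in a..b, h x) : AbsolutelyContinuousOnLine m := by
  intro ε hε
  obtain ⟨δ, hδ, hsmall⟩ := exists_pos_setLIntegral_lt_of_measure_lt (μ := volume)
    (f := fun x => ‖h x‖ₑ) hh.2.ne (ε := ENNReal.ofReal ε) (by simpa using hε)
  obtain ⟨δ', hδ', hδδ⟩ : ∃ δ' : ℝ, 0 < δ' ∧ ENNReal.ofReal δ' ≤ δ := by
    rcases eq_or_ne δ ∞ with rfl | h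
    · exact ⟨1, one_pos, le_top⟩
    · exact ⟨δ.toReal, ENNReal.toReal_pos hδ.ne' h, ENNReal.ofReal_toReal_le⟩
  refine ⟨δ', hδ', fun n a b hab hdisj hlen => ?_⟩
  have hvol : volume (⋃ i, Set.Ioc (a i) (b i)) < δ := by
    calc volume (⋃ i, Set.Ioc (a i) (b i)) ≤ ∑ i, volume (Set.Ioc (a i) (b i)) :=
          measure_iUnion_fintype_le _ _
      _ = ENNReal.ofReal (∑ i, (b i - a i)) := by
          rw [ENNReal.ofReal_sum_of_nonneg fun i _ => sub_nonneg.2 (hab i)]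
          simp only [Real.volume_Ioc]
      _ < ENNReal.ofReal δ' := (ENNReal.ofReal_lt_ofReal_iff hδ').2 hlen
      _ ≤ δ := hδδ
  have hlt := hsmall _ hvol
  rw [lintegral_iUnion (fun i => measurableSet_Ioc) (fun i j hij => hdisj i j hij),
    tsum_fintype] at hlt
  rw [← ENNReal.ofReal_lt_ofReal_iff hε]
  refine lt_of_le_of_lt ?_ hlt
  rw [ENNReal.ofReal_sum_of_nonneg fun i _ => abs_nonneg _]
  refine Finset.sum_le_sum fun i _ => ?_
  rw [hm, intervalIntegral.integral_of_le (hab i), ← Real.norm_eq_abs, ofReal_norm]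
  exact enorm_integral_le_lintegral_enorm _

lemma continuous_of_integral {m h : ℝ → ℝ} (hh : Integrable h)
    (hm : ∀ a b, m b - m a = ∫ x in a..b, h x) : Continuous m := by
  have h1 : m = fun x => m 0 + ∫ t in (0 : ℝ)..x, h t := by
    ext x
    rw [← hm 0 x]; ring
  rw [h1]
  exact continuous_const.add
    (intervalIntegral.continuous_primitive (fun a b => hh.intervalIntegrable) 0)

lemma ae_hasDerivAt_of_integral {m h : ℝ → ℝ} (hh : Integrable h)
    (hm : ∀ a b, m b - m a = ∫ x in a..b, h x) : ∀ᵐ x, HasDerivAt m (h x) x := by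
  have h1 : m = fun x => m 0 + ∫ t in (0 : ℝ)..x, h t := by
    ext x
    rw [← hm 0 x]; ring
  filter_upwards [LocallyIntegrable.ae_hasDerivAt_integral hh.locallyIntegrable] with x hx
  rw [h1]
  exact (hx 0).const_add _

lemma absolutelyContinuousOnInterval_of_integral {m h : ℝ → ℝ} (hh : Integrable h)
    (hm : ∀ a b, m b - m a = ∫ x in a..b, h x) (a b : ℝ) :
    AbsolutelyContinuousOnInterval m a b := by
  have h1 : m = fun x => m a + ∫ t in a..x, h t := by
    ext x
    rw [← hm a x]; ring
  rw [h1]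
  refine AbsolutelyContinuousOnInterval.fun_add ?_
    (hh.intervalIntegrable.absolutelyContinuousOnInterval_intervalIntegral (by simp))
  exact ((LipschitzWith.const (m a)).lipschitzOnWith
    (s := Set.uIcc a b)).absolutelyContinuousOnInterval

/-- Finite Fisher information of scale: the punctured measure has a density `f` such that `x f(x)`
is an indefinite integral of `g f` for some `g ∈ L₂(F)`. -/
theorem exists_isScaleDensity_and_score (F : Measure ℝ) [IsProbabilityMeasure F]
    (hF : fisherInfoScale F < ∞) :
    ∃ f g : ℝ → ℝ, IsScaleDensity F f ∧ Measurable g ∧ MemLp g 2 F ∧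
      Integrable (fun x => g x * f x) ∧
      ∀ a b, b * f b - a * f a = ∫ x in a..b, g x * f x := by
  obtain ⟨g, hgm, hg2, hdual⟩ := exists_dual_score F hF
  have hg1 : Integrable g F := hg2.integrable (by norm_num)
  set M : ℝ → ℝ := fun y => -∫ x in Set.Ici y, g x ∂F with hMdef
  have hMm : Measurable M := (measurable_integral_Ici F hgm).neg
  have hMb : ∀ y, ‖M y‖ ≤ ∫ x, ‖g x‖ ∂F := fun y => by
    rw [hMdef, norm_neg]; exact norm_setIntegral_le hg1 _
  have hparts : ∀ ψ : ℝ → ℝ, Continuous ψ → HasCompactSupport ψ →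
      ∫ x, x * ψ x ∂F = ∫ y, ψ y * M y :=
    fun ψ hψ hs => integral_mul_eq_integral_mul_tail hg1 hdual hψ hs
  have hac := puncture_absolutelyContinuous_of_integral_eq hMm hMb hparts
  have hfinP : IsFiniteMeasure (puncture F) := by unfold puncture; infer_instance
  set f₀ : ℝ → ℝ := fun x => ((puncture F).rnDeriv volume x).toReal with hf₀
  have hf₀m : Measurable f₀ := (Measure.measurable_rnDeriv _ _).ennreal_toReal
  have hf₀nn : ∀ x, 0 ≤ f₀ x := fun x => ENNReal.toReal_nonneg
  have hdens : puncture F = volume.withDensity fun x => ENNReal.ofReal (f₀ x) := by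
    conv_lhs => rw [← Measure.withDensity_rnDeriv_eq _ _ hac]
    refine withDensity_congr_ae ?_
    filter_upwards [(puncture F).rnDeriv_lt_top volume] with x hx
    rw [hf₀, ENNReal.ofReal_toReal hx.ne]
  have hf₀i : Integrable f₀ := Measure.integrable_toReal_rnDeriv
  have hgP : Integrable g (puncture F) := hg1.mono_measure Measure.restrict_le_self
  have hgf₀ : Integrable fun x => g x * f₀ x := by
    rw [hdens, integrable_withDensity_iff (by fun_prop)
      (Eventually.of_forall fun _ => ENNReal.ofReal_lt_top)] at hgP
    simpa only [ENNReal.toReal_ofReal (hf₀nn _)] using hgP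
  -- The density of `x F(dx)`.
  have hMf₀ : ∀ᵐ x, M x = x * f₀ x := by
    refine ae_eq_of_integral_contDiff_smul_eq ?_ ?_ fun ψ hψ hs => ?_
    · exact (locallyIntegrable_const (∫ x, ‖g x‖ ∂F)).mono hMm.aestronglyMeasurable
        (Eventually.of_forall fun x => (hMb x).trans (le_abs_self _))
    · exact hf₀i.locallyIntegrable.continuous_mul continuous_id
    · simp only [smul_eq_mul]
      rw [← hparts ψ hψ.continuous hs]
      have h1 : ∫ x, x * ψ x ∂F = ∫ x, x * ψ x ∂(puncture F) := by
        rw [puncture, setIntegral_eq_integral_of_forall_compl_eq_zero]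
        intro x hx
        simp only [Set.mem_compl_iff, Set.mem_singleton_iff, not_not] at hx
        rw [hx, zero_mul]
      rw [h1, hdens, integral_withDensity_ofReal _ hf₀m]
      refine integral_congr_ae (Eventually.of_forall fun x => ?_)
      simp only [max_eq_left (hf₀nn x)]
      ring
  -- Since `g dF` has no mass at `0`, `F` may be replaced by its absolutely continuous part;
  -- otherwise `M` could jump at `0`.
  have hMint : ∀ y, M y = -∫ x in Set.Ici y, g x * f₀ x := by
    intro y
    have h0 : ∫ x in Set.Ici y ∩ {0}, g x ∂F = 0 := by
      by_cases hy : (0 : ℝ) ∈ Set.Ici y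
      · rw [Set.inter_eq_right.2 (by simpa using hy)]
        exact integral_singleton_zero_of_dual hg1 hdual
      · rw [Set.inter_singleton_eq_empty.2 hy]
        simp
    have h1 := integral_inter_add_sdiff (μ := F) (f := g) (s := Set.Ici y)
      (measurableSet_singleton (0 : ℝ)) hg1.integrableOn
    rw [h0, zero_add] at h1
    have h2 : ∫ x in Set.Ici y \ {0}, g x ∂F = ∫ x in Set.Ici y, g x ∂(puncture F) := by
      rw [puncture, Measure.restrict_restrict measurableSet_Ici, Set.sdiff_eq]
    simp only [hMdef]
    rw [← h1, h2, hdens, restrict_withDensity measurableSet_Ici, integral_withDensity_ofReal _ hf₀m]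
    simp only [max_eq_left (hf₀nn _), mul_comm]
  have hMdiff : ∀ a b, M b - M a = ∫ x in a..b, g x * f₀ x := by
    intro a b
    rw [hMint, hMint, ← intervalIntegral.integral_Ici_sub_Ici' hgf₀.integrableOn hgf₀.integrableOn]
    ring
  have hMc : Continuous M := continuous_of_integral hgf₀ hMdiff
  -- The sign holds almost everywhere because `M = x f₀`, and everywhere by continuity. It forces `M
  -- 0 = 0`, so that `M x / x` satisfies `x * f x = M x` at `0` as well.
  have hxM : ∀ x, 0 ≤ x * M x := by
    have hae : (fun x => x * M x) =ᵐ[volume] fun x => |x * M x| := by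
      filter_upwards [hMf₀] with x hx
      rw [hx, abs_of_nonneg]
      rw [← mul_assoc]
      exact mul_nonneg (mul_self_nonneg x) (hf₀nn x)
    have heq := (Continuous.ae_eq_iff_eq (μ := (volume : Measure ℝ))
      (continuous_id.mul hMc) (continuous_id.mul hMc).abs).1 hae
    intro x
    have h1 : x * M x = |x * M x| := congrFun heq x
    rw [h1]
    exact abs_nonneg _
  have hM0 : M 0 = 0 := by
    refine le_antisymm ?_ ?_
    · refine le_of_tendsto (hMc.tendsto 0 |>.mono_left (nhdsWithin_le_nhds (s := Set.Iio 0))) ?_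
      filter_upwards [self_mem_nhdsWithin] with x hx
      have hx : x < 0 := hx
      nlinarith [hxM x]
    · refine ge_of_tendsto (hMc.tendsto 0 |>.mono_left (nhdsWithin_le_nhds (s := Set.Ioi 0))) ?_
      filter_upwards [self_mem_nhdsWithin] with x hx
      have hx : 0 < x := hx
      nlinarith [hxM x]
  set f : ℝ → ℝ := fun x => M x / x with hf
  have hxf : ∀ x, x * f x = M x := by
    intro x
    by_cases hx : x = 0
    · simp [hx, hM0]
    · simp only [hf]; field_simp
  have hff₀ : ∀ᵐ x, f x = f₀ x := by
    filter_upwards [hMf₀, Measure.ae_ne volume (0 : ℝ)] with x hx hx0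
    rw [hf]
    simp only [hx]
    field_simp
  have hgf : (fun x => g x * f₀ x) =ᵐ[volume] fun x => g x * f x := by
    filter_upwards [hff₀] with x hx
    rw [hx]
  have hdiff : ∀ a b, b * f b - a * f a = ∫ x in a..b, g x * f x := by
    intro a b
    rw [hxf, hxf, hMdiff]
    exact intervalIntegral.integral_congr_ae (hgf.mono fun x hx _ => hx)
  have hgfi : Integrable fun x => g x * f x := hgf₀.congr hgf
  refine ⟨f, g, ⟨hMm.div measurable_id, fun x => ?_, ?_, ?_⟩, hgm, hg2, hgfi, hdiff⟩
  · have h1 : f x = x * M x / (x * x) := by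
      by_cases hx : x = 0
      · simp [hf, hx]
      · simp only [hf]; field_simp
    rw [h1]
    exact div_nonneg (hxM x) (mul_self_nonneg x)
  · rw [hdens]
    refine withDensity_congr_ae ?_
    filter_upwards [hff₀] with x hx
    rw [hx]
  · exact absolutelyContinuousOnLine_of_integral hgfi hdiff

lemma AbsolutelyContinuousOnLine.continuous {m : ℝ → ℝ} (hm : AbsolutelyContinuousOnLine m) :
    Continuous m := by
  have key : ∀ ε > 0, ∃ δ > 0, ∀ x y, x ≤ y → y - x < δ → |m y - m x| < ε := by
    intro ε hε
    obtain ⟨δ, hδ, h⟩ := hm ε hε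
    refine ⟨δ, hδ, fun x y hxy hd => ?_⟩
    have := h 1 (fun _ => x) (fun _ => y) (fun _ => hxy)
      (fun i j hij => absurd (Subsingleton.elim i j) hij) (by simpa using hd)
    simpa using this
  rw [Metric.continuous_iff]
  intro x ε hε
  obtain ⟨δ, hδ, h⟩ := key ε hε
  refine ⟨δ, hδ, fun y hy => ?_⟩
  rw [Real.dist_eq] at hy ⊢
  rcases le_total x y with hxy | hxy
  · exact h x y hxy ((le_abs_self _).trans_lt hy)
  · rw [abs_sub_comm] at hy ⊢
    exact h y x hxy ((le_abs_self _).trans_lt hy)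

/-- Two densities agree almost everywhere, and `x f(x)` is continuous. Thus only `f 0` is free, and
a score found for one version serves all. -/
lemma IsScaleDensity.mul_eq_mul {F : Measure ℝ} [IsFiniteMeasure F] {f₁ f₂ : ℝ → ℝ}
    (h₁ : IsScaleDensity F f₁) (h₂ : IsScaleDensity F f₂) (x : ℝ) : x * f₁ x = x * f₂ x := by
  have hfinP : IsFiniteMeasure (puncture F) := by unfold puncture; infer_instance
  have hae : (fun x => ENNReal.ofReal (f₁ x)) =ᵐ[volume] fun x => ENNReal.ofReal (f₂ x) := by
    rw [← withDensity_eq_iff]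
    · rw [← h₁.density, h₂.density]
    · exact h₁.measurable.ennreal_ofReal.aemeasurable
    · exact h₂.measurable.ennreal_ofReal.aemeasurable
    · rw [← setLIntegral_univ, ← withDensity_apply _ MeasurableSet.univ, ← h₁.density]
      exact measure_ne_top _ _
  refine congrFun ((Continuous.ae_eq_iff_eq (μ := (volume : Measure ℝ)) h₁.absCont.continuous
    h₂.absCont.continuous).1 ?_) x
  filter_upwards [hae] with y hy
  rw [(ENNReal.ofReal_eq_ofReal_iff (h₁.nonneg y) (h₂.nonneg y)).1 hy]

/-! ### The Hellinger bound and the pointwise derivative for the scale family. -/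

lemma lintegral_eq_lintegral_Ioi_add_neg (G : ℝ → ℝ≥0∞) :
    ∫⁻ x, G x = (∫⁻ x in Set.Ioi 0, G x) + ∫⁻ x in Set.Ioi 0, G (-x) := by
  rw [← lintegral_add_compl G (measurableSet_Ioi (a := (0 : ℝ)))]
  congr 1
  rw [Set.compl_Ioi, setLIntegral_congr Iio_ae_eq_Iic.symm]
  have h := (Measure.measurePreserving_neg (volume : Measure ℝ)).setLIntegral_comp_preimage_emb
    (MeasurableEquiv.neg ℝ).measurableEmbedding G (Set.Iio 0)
  rw [← h]
  congr 2
  ext x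
  simp

lemma lintegral_comp_div {σ : ℝ} (hσ : 0 < σ) {G : ℝ → ℝ≥0∞} (hG : Measurable G) :
    ∫⁻ x, ENNReal.ofReal σ⁻¹ * G (x / σ) = ∫⁻ x, G x := by
  have h := Real.map_volume_mul_left (inv_ne_zero hσ.ne')
  rw [inv_inv, abs_of_pos hσ] at h
  rw [lintegral_const_mul _ (by fun_prop)]
  have h2 : ∫⁻ x, G (x / σ) = ENNReal.ofReal σ * ∫⁻ x, G x := by
    rw [← smul_eq_mul, ← lintegral_smul_measure, ← h, lintegral_map hG (by fun_prop)]
    simp only [div_eq_inv_mul]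
  rw [h2, ← mul_assoc, ← ENNReal.ofReal_mul (by positivity), inv_mul_cancel₀ hσ.ne']
  simp

lemma lintegral_Ioi_sq_sqrt_scaled_sub_le {f g : ℝ → ℝ} (hf : Measurable f) (hg : Measurable g)
    (hnn : ∀ x, 0 ≤ f x) (hint : Integrable fun x => g x * f x)
    (hdiff : ∀ a b, b * f b - a * f a = ∫ x in a..b, g x * f x) {s t : ℝ} (hs : 0 < s)
    (hst : s ≤ t) :
    ∫⁻ x in Set.Ioi 0, ENNReal.ofReal ((√(f (x / s) / s) - √(f (x / t) / t)) ^ 2) ≤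
      ENNReal.ofReal ((t - s) ^ 2 / (s * t)) *
        ∫⁻ y in Set.Ioi 0, ENNReal.ofReal (g y ^ 2 * f y / 4) := by
  have ht : 0 < t := hs.trans_le hst
  have h := lintegral_Ioi_sq_sqrt_sub_sqrt_le (m := fun x => x * f x) (h := fun x => g x * f x)
    (by fun_prop) (by fun_prop) (absolutelyContinuousOnInterval_of_integral hint hdiff)
    (ae_hasDerivAt_of_integral hint hdiff) (fun x hx => mul_nonneg hx.le (hnn x))
    (fun x hx h0 => by
      rcases mul_eq_zero.1 h0 with h0 | h0
      · exact absurd h0 hx.ne'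
      · rw [h0, mul_zero]) hs hst
  -- Pulling out `√x` reduces two scales to two values of the single function `√(y f(y))`.
  have hroot : ∀ x r : ℝ, 0 < x → 0 < r → √(f (x / r) / r) = √(x / r * f (x / r)) / √x := by
    intro x r hx hr
    rw [← Real.sqrt_div' _ hx.le]
    congr 1
    field_simp
  calc _ = ∫⁻ x in Set.Ioi 0,
        ENNReal.ofReal ((√(x / s * f (x / s)) - √(x / t * f (x / t))) ^ 2 / x) := by
        refine setLIntegral_congr_fun measurableSet_Ioi fun x hx => ?_
        have hx : 0 < x := hx
        rw [hroot x s hx hs, hroot x t hx ht, ← sub_div, div_pow, Real.sq_sqrt hx.le]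
    _ ≤ _ := h
    _ = _ := by
        congr 1
        refine setLIntegral_congr_fun measurableSet_Ioi fun y hy => ?_
        have hy : 0 < y := hy
        congr 1
        by_cases h0 : f y = 0
        · simp [h0]
        · field_simp

/-- The Hellinger distance between two members of a scale family is controlled by its Fisher
information. -/
lemma lintegral_sq_sqrt_scaled_sub_le_of_le {f g : ℝ → ℝ} (hf : Measurable f) (hg : Measurable g)
    (hnn : ∀ x, 0 ≤ f x) (hint : Integrable fun x => g x * f x)
    (hdiff : ∀ a b, b * f b - a * f a = ∫ x in a..b, g x * f x) {s t : ℝ} (hs : 0 < s)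
    (hst : s ≤ t) :
    ∫⁻ x, ENNReal.ofReal ((√(f (x / s) / s) - √(f (x / t) / t)) ^ 2) ≤
      ENNReal.ofReal ((t - s) ^ 2 / (s * t)) * ∫⁻ y, ENNReal.ofReal (g y ^ 2 * f y / 4) := by
  rw [lintegral_eq_lintegral_Ioi_add_neg, lintegral_eq_lintegral_Ioi_add_neg
    (fun y => ENNReal.ofReal (g y ^ 2 * f y / 4)), mul_add]
  refine add_le_add (lintegral_Ioi_sq_sqrt_scaled_sub_le hf hg hnn hint hdiff hs hst) ?_
  -- The negative half-line is the positive one for the reflected pair `f (-x)`, `g (-x)`, which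
  -- satisfies the same integral identity.
  simp only [neg_div]
  refine lintegral_Ioi_sq_sqrt_scaled_sub_le (f := fun x => f (-x)) (g := fun x => g (-x))
    (by fun_prop) (by fun_prop) (fun x => hnn _) hint.comp_neg (fun a b => ?_) hs hst
  rw [intervalIntegral.integral_comp_neg (fun x => g x * f x), ← hdiff]
  ring

lemma lintegral_sq_sqrt_scaled_sub_le {f g : ℝ → ℝ} (hf : Measurable f) (hg : Measurable g)
    (hnn : ∀ x, 0 ≤ f x) (hint : Integrable fun x => g x * f x)
    (hdiff : ∀ a b, b * f b - a * f a = ∫ x in a..b, g x * f x) {s t : ℝ} (hs : 0 < s)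
    (ht : 0 < t) :
    ∫⁻ x, ENNReal.ofReal ((√(f (x / s) / s) - √(f (x / t) / t)) ^ 2) ≤
      ENNReal.ofReal ((t - s) ^ 2 / (s * t)) * ∫⁻ y, ENNReal.ofReal (g y ^ 2 * f y / 4) := by
  rcases le_total s t with hst | hst
  · exact lintegral_sq_sqrt_scaled_sub_le_of_le hf hg hnn hint hdiff hs hst
  · have h := lintegral_sq_sqrt_scaled_sub_le_of_le hf hg hnn hint hdiff ht hst
    rw [mul_comm t s, ← neg_sub t s, neg_sq] at h
    convert h using 4
    ring

/-- Writing `f (x / τ) / τ` as `(x / τ) f (x / τ) / x` leaves only `y f(y)` to be differentiated;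
positivity at `x / σ` makes the square root differentiable. -/
lemma hasDerivAt_sqrt_scaled {f : ℝ → ℝ} {x σ d : ℝ} (hx : x ≠ 0) (hσ : 0 < σ)
    (hf : 0 < f (x / σ)) (hd : HasDerivAt (fun y => y * f y) d (x / σ)) :
    HasDerivAt (fun τ => √(f (x / τ) / τ))
      (1 / 2 * (σ⁻¹ * (-d / f (x / σ))) * √(f (x / σ) / σ)) σ := by
  have h1 : HasDerivAt (fun τ => x / τ) (-x / σ ^ 2) σ := by
    have := (hasDerivAt_inv hσ.ne').const_mul x
    simpa only [div_eq_mul_inv, mul_neg, neg_mul] using this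
  have h2 : HasDerivAt (fun τ => x / τ * f (x / τ) / x) (d * (-x / σ ^ 2) / x) σ :=
    (HasDerivAt.comp σ hd h1).div_const x
  have hev : (fun τ => f (x / τ) / τ) =ᶠ[𝓝 σ] fun τ => x / τ * f (x / τ) / x := by
    filter_upwards [lt_mem_nhds hσ] with τ hτ
    field_simp
  have h3 := (h2.congr_of_eventuallyEq hev).sqrt (by positivity)
  convert h3 using 1
  have hS : 0 < √(f (x / σ) / σ) := Real.sqrt_pos.2 (by positivity)
  have hS2 : √(f (x / σ) / σ) ^ 2 = f (x / σ) / σ := Real.sq_sqrt (by positivity)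
  rw [eq_div_iff (by positivity)]
  calc 1 / 2 * (σ⁻¹ * (-d / f (x / σ))) * √(f (x / σ) / σ) * (2 * √(f (x / σ) / σ))
      = σ⁻¹ * (-d / f (x / σ)) * √(f (x / σ) / σ) ^ 2 := by ring
    _ = d * (-x / σ ^ 2) / x := by
      rw [hS2]
      field_simp

/-! ### Square roots of measures, the score, and densities with an atom at the origin. -/

/-- The norm `‖√dQ - g √dP‖` can be computed with any σ-finite dominating measure. -/
lemma sqrtMeasureDist_withDensity {ν : Measure ℝ} [SigmaFinite ν] {q p g : ℝ → ℝ}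
    (hq : Measurable q) (hp : Measurable p) (hg : Measurable g) (hq0 : ∀ x, 0 ≤ q x)
    (hp0 : ∀ x, 0 ≤ p x) :
    sqrtMeasureDist (ν.withDensity fun x => ENNReal.ofReal (q x))
        (ν.withDensity fun x => ENNReal.ofReal (p x)) g =
      (∫⁻ x, ENNReal.ofReal ((√(q x) - √(p x) * g x) ^ 2) ∂ν) ^ (1 / 2 : ℝ) := by
  set Q := ν.withDensity fun x => ENNReal.ofReal (q x)
  set P := ν.withDensity fun x => ENNReal.ofReal (p x)
  have hsum : Q + P = ν.withDensity fun x => ENNReal.ofReal (q x + p x) := by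
    rw [← withDensity_add_left (by fun_prop)]
    congr 1
    ext x
    simp only [Pi.add_apply]
    rw [ENNReal.ofReal_add (hq0 x) (hp0 x)]
  have hsf : SigmaFinite (Q + P) := by
    rw [hsum]
    exact SigmaFinite.withDensity_ofReal _
  -- The bound `w ≤ q + p` makes the default value `w / 0 = 0` correct where `q + p` vanishes.
  have hrn : ∀ w : ℝ → ℝ, Measurable w → (∀ x, 0 ≤ w x) → (∀ x, w x ≤ q x + p x) →
      (ν.withDensity fun x => ENNReal.ofReal (w x)).rnDeriv (Q + P) =ᵐ[Q + P]
        fun x => ENNReal.ofReal (w x / (q x + p x)) := by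
    intro w hw hw0 hwle
    have : (ν.withDensity fun x => ENNReal.ofReal (w x)) =
        (Q + P).withDensity fun x => ENNReal.ofReal (w x / (q x + p x)) := by
      rw [hsum, ← withDensity_mul _ (by fun_prop) (by fun_prop)]
      congr 1
      ext x
      have hs : 0 ≤ q x + p x := add_nonneg (hq0 x) (hp0 x)
      rw [Pi.mul_apply, ← ENNReal.ofReal_mul hs]
      congr 1
      rcases hs.eq_or_lt with h0 | h0
      · have := hwle x
        rw [← h0] at this ⊢
        rw [zero_mul]
        exact le_antisymm this (hw0 x)
      · field_simp
    rw [this]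
    exact Measure.rnDeriv_withDensity _ (by fun_prop)
  have hQ := hrn q hq hq0 fun x => le_add_of_nonneg_right (hp0 x)
  have hP := hrn p hp hp0 fun x => le_add_of_nonneg_left (hq0 x)
  have hcongr : (fun x => √(Q.rnDeriv (Q + P) x).toReal - √(P.rnDeriv (Q + P) x).toReal * g x)
      =ᵐ[Q + P] fun x => √(q x / (q x + p x)) - √(p x / (q x + p x)) * g x := by
    filter_upwards [hQ, hP] with x h1 h2
    have hs : 0 ≤ q x + p x := add_nonneg (hq0 x) (hp0 x)
    rw [h1, h2, ENNReal.toReal_ofReal (div_nonneg (hq0 x) hs),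
      ENNReal.toReal_ofReal (div_nonneg (hp0 x) hs)]
  rw [sqrtMeasureDist, eLpNorm_congr_ae hcongr,
    eLpNorm_eq_lintegral_rpow_enorm_toReal (by norm_num) (by norm_num), hsum,
    lintegral_withDensity_eq_lintegral_mul _ (by fun_prop) (by fun_prop)]
  congr 1
  refine lintegral_congr fun x => ?_
  have hs : 0 ≤ q x + p x := add_nonneg (hq0 x) (hp0 x)
  rw [Pi.mul_apply, ENNReal.toReal_ofNat, ENNReal.rpow_two, ← ofReal_norm,
    ← ENNReal.ofReal_pow (norm_nonneg _), Real.norm_eq_abs, sq_abs, ← ENNReal.ofReal_mul hs]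
  congr 1
  rcases hs.eq_or_lt with h0 | h0
  · have h1 : q x = 0 := by linarith [hq0 x, hp0 x]
    have h2 : p x = 0 := by linarith [hq0 x, hp0 x]
    simp [h1, h2]
  · rw [Real.sqrt_div' _ hs, Real.sqrt_div' _ hs, div_mul_eq_mul_div, ← sub_div, div_pow,
      Real.sq_sqrt hs]
    field_simp

lemma IsScaleDensity.exists_score {F : Measure ℝ} [IsProbabilityMeasure F]
    (hF : fisherInfoScale F < ∞) {f : ℝ → ℝ} (hf : IsScaleDensity F f) :
    ∃ g : ℝ → ℝ, Measurable g ∧ MemLp g 2 F ∧ Integrable (fun x => g x * f x) ∧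
      ∀ a b, b * f b - a * f a = ∫ x in a..b, g x * f x := by
  obtain ⟨f₁, g, hf₁, hgm, hg2, hint, hdiff⟩ := exists_isScaleDensity_and_score F hF
  have hae : ∀ᵐ x, g x * f₁ x = g x * f x := by
    filter_upwards [Measure.ae_ne volume (0 : ℝ)] with x hx
    rw [mul_left_cancel₀ hx (hf₁.mul_eq_mul hf x)]
  refine ⟨g, hgm, hg2, hint.congr hae, fun a b => ?_⟩
  rw [hf.mul_eq_mul hf₁, hf.mul_eq_mul hf₁, hdiff]
  exact intervalIntegral.integral_congr_ae (hae.mono fun x hx _ => hx)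

lemma measurable_scaleScore {f : ℝ → ℝ} (hf : Measurable f) : Measurable (scaleScore f) :=
  Measurable.ite (measurableSet_singleton 0) measurable_const
    ((measurable_deriv _).neg.div hf)

lemma scaleScore_ae_eq {f g : ℝ → ℝ} (hint : Integrable fun x => g x * f x)
    (hdiff : ∀ a b, b * f b - a * f a = ∫ x in a..b, g x * f x) :
    ∀ᵐ x, f x ≠ 0 → scaleScore f x = -g x := by
  filter_upwards [ae_hasDerivAt_of_integral (m := fun x => x * f x) hint hdiff,
    Measure.ae_ne volume (0 : ℝ)] with x hx hx0 hfx
  rw [scaleScore, if_neg hx0, hx.deriv]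
  field_simp

lemma eq_puncture_add (F : Measure ℝ) : F = F {0} • Measure.dirac 0 + puncture F := by
  rw [puncture, ← Measure.restrict_singleton, Measure.restrict_add_restrict_compl
    (measurableSet_singleton 0)]

/-- The score is dominated by `g` `F`-almost everywhere: it is `0` at the possible atom, whatever `g
0` is, and equals `-g` almost everywhere for the punctured measure, which does not charge `{f = 0}`.
-/
lemma IsScaleDensity.memLp_scaleScore {F : Measure ℝ} {f g : ℝ → ℝ}
    (hf : IsScaleDensity F f) (hg2 : MemLp g 2 F)
    (hint : Integrable fun x => g x * f x)
    (hdiff : ∀ a b, b * f b - a * f a = ∫ x in a..b, g x * f x) : MemLp (scaleScore f) 2 F := by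
  refine hg2.mono (measurable_scaleScore hf.measurable).aestronglyMeasurable ?_
  rw [eq_puncture_add F, ae_add_measure_iff]
  constructor
  · refine Measure.ae_smul_measure ?_ _
    rw [ae_dirac_eq]
    simp [scaleScore]
  · rw [hf.density, ae_withDensity_iff hf.measurable.ennreal_ofReal]
    filter_upwards [scaleScore_ae_eq hint hdiff] with x hx hfx
    rw [hx (fun h => hfx (by simp [h])), norm_neg]

/-- The density of `F_σ` with respect to the sum of the Dirac measure at zero and Lebesgue
measure. -/
noncomputable def scaledDensity (F : Measure ℝ) (f : ℝ → ℝ) (σ x : ℝ) : ℝ :=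
  if x = 0 then F.real {0} else f (x / σ) / σ

lemma measurable_scaledDensity (F : Measure ℝ) {f : ℝ → ℝ} (hf : Measurable f) (σ : ℝ) :
    Measurable (scaledDensity F f σ) :=
  Measurable.ite (measurableSet_singleton 0) measurable_const (by fun_prop)

lemma scaledDensity_nonneg (F : Measure ℝ) {f : ℝ → ℝ} (hf : ∀ x, 0 ≤ f x) {σ : ℝ} (hσ : 0 < σ)
    (x : ℝ) : 0 ≤ scaledDensity F f σ x := by
  unfold scaledDensity
  split_ifs
  · exact measureReal_nonneg
  · exact div_nonneg (hf _) hσ.le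

lemma IsScaleDensity.scaleFamily_eq {F : Measure ℝ} [IsFiniteMeasure F] {f : ℝ → ℝ}
    (hf : IsScaleDensity F f) {σ : ℝ} (hσ : 0 < σ) :
    scaleFamily F σ = (Measure.dirac (0 : ℝ) + volume).withDensity
      fun x => ENNReal.ofReal (scaledDensity F f σ x) := by
  have hfm := hf.measurable
  have hm : Measurable fun x : ℝ => σ * x := measurable_const_mul σ
  rw [withDensity_add_measure, dirac_withDensity, scaleFamily]
  conv_lhs => rw [eq_puncture_add F]
  rw [Measure.map_add _ _ hm, Measure.map_smul, Measure.map_dirac' hm, mul_zero]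
  congr 1
  · simp [scaledDensity, Measure.real]
  · have hae : (fun x => ENNReal.ofReal (scaledDensity F f σ x)) =ᵐ[volume]
        fun x => ENNReal.ofReal σ⁻¹ * ENNReal.ofReal (f (x / σ)) := by
      filter_upwards [Measure.ae_ne volume (0 : ℝ)] with x hx
      rw [scaledDensity, if_neg hx, ← ENNReal.ofReal_mul (by positivity), div_eq_inv_mul]
    rw [withDensity_congr_ae hae, hf.density]
    ext A hA
    rw [Measure.map_apply hm hA, withDensity_apply _ (hm hA), withDensity_apply _ hA,
      ← lintegral_indicator (hm hA), ← lintegral_indicator hA,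
      ← lintegral_comp_div hσ (G := ((fun x => σ * x) ⁻¹' A).indicator fun x => ENNReal.ofReal (f x))
        (hfm.ennreal_ofReal.indicator (hm hA))]
    refine lintegral_congr fun x => ?_
    have : x / σ ∈ (fun x => σ * x) ⁻¹' A ↔ x ∈ A := by
      rw [Set.mem_preimage, mul_div_cancel₀ _ hσ.ne']
    by_cases hx : x ∈ A
    · rw [Set.indicator_of_mem (this.2 hx), Set.indicator_of_mem hx]
    · rw [Set.indicator_of_notMem (fun h => hx (this.1 h)), Set.indicator_of_notMem hx, mul_zero]

/-- Both densities equal `F {0}` at the origin, so `u 0 = 1` cancels the atom and only the Lebesgue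
part remains. This is where `Λ(0) = 0` enters. -/
lemma IsScaleDensity.sqrtMeasureDist_eq {F : Measure ℝ} [IsFiniteMeasure F] {f : ℝ → ℝ}
    (hf : IsScaleDensity F f) {σ τ : ℝ} (hσ : 0 < σ) (hτ : 0 < τ) {u : ℝ → ℝ} (hu : Measurable u)
    (hu0 : u 0 = 1) :
    sqrtMeasureDist (scaleFamily F τ) (scaleFamily F σ) u =
      (∫⁻ x, ENNReal.ofReal ((√(f (x / τ) / τ) - √(f (x / σ) / σ) * u x) ^ 2)) ^ (1 / 2 : ℝ) := by
  have hfm := hf.measurable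
  have h1 := measurable_scaledDensity F hfm σ
  have h2 := measurable_scaledDensity F hfm τ
  rw [hf.scaleFamily_eq hσ, hf.scaleFamily_eq hτ, sqrtMeasureDist_withDensity
    h2 h1 hu (scaledDensity_nonneg F hf.nonneg hτ) (scaledDensity_nonneg F hf.nonneg hσ),
    lintegral_add_measure, lintegral_dirac]
  congr 1
  rw [hu0]
  simp only [scaledDensity, if_true, mul_one, sub_self, ne_eq, OfNat.ofNat_ne_zero,
    not_false_eq_true, zero_pow, ENNReal.ofReal_zero, zero_add]
  refine lintegral_congr_ae ?_
  filter_upwards [Measure.ae_ne volume (0 : ℝ)] with x hx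
  simp only [if_neg hx]

lemma ae_comp_div {p : ℝ → Prop} (hp : ∀ᵐ x, p x) {σ : ℝ} (hσ : 0 < σ) : ∀ᵐ x, p (x / σ) := by
  have h := Real.map_volume_mul_left (inv_ne_zero hσ.ne')
  have hq : Measure.QuasiMeasurePreserving (fun x : ℝ => σ⁻¹ * x) := by
    refine ⟨by fun_prop, ?_⟩
    rw [h]
    exact Measure.smul_absolutelyContinuous
  simpa only [div_eq_inv_mul] using hq.ae hp

/-! ### Differentiability in `L₂`. -/

/-- `L₂`-convergence of the difference quotients of `σ ↦ √f_σ`. -/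
lemma IsScaleDensity.tendsto_lintegral_sq_slope {F : Measure ℝ} [IsFiniteMeasure F]
    {f g : ℝ → ℝ} (hf : IsScaleDensity F f) (hgm : Measurable g) (hg2 : MemLp g 2 F)
    (hint : Integrable fun x => g x * f x)
    (hdiff : ∀ a b, b * f b - a * f a = ∫ x in a..b, g x * f x) {σ : ℝ} (hσ : 0 < σ) :
    Tendsto (fun t : ℝ => ∫⁻ x, ENNReal.ofReal
      ((t⁻¹ * (√(f (x / (σ + t)) / (σ + t)) - √(f (x / σ) / σ)) -
        1 / 2 * scaleScoreAt f σ x * √(f (x / σ) / σ)) ^ 2)) (𝓝[≠] 0) (𝓝 0) := by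
  have hfm := hf.measurable
  have hΛm : Measurable (scaleScore f) := measurable_scaleScore hfm
  have hΛσm : Measurable (scaleScoreAt f σ) := by unfold scaleScoreAt; fun_prop
  set J := ∫⁻ y, ENNReal.ofReal (g y ^ 2 * f y / 4) with hJ
  have hJfin : J ≠ ∞ := by
    have h1 : ∫⁻ y, ENNReal.ofReal (f y) * ENNReal.ofReal (g y ^ 2) < ∞ := by
      have h2 := hg2.integrable_sq.lintegral_lt_top
      have h3 : ∫⁻ y, ENNReal.ofReal (g y ^ 2) ∂(puncture F) < ∞ :=
        (lintegral_mono' Measure.restrict_le_self le_rfl).trans_lt h2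
      rw [hf.density, lintegral_withDensity_eq_lintegral_mul _ (by fun_prop) (by fun_prop)] at h3
      exact h3
    refine ne_of_lt (lt_of_le_of_lt (lintegral_mono fun y => ?_) h1)
    rw [← ENNReal.ofReal_mul (hf.nonneg y)]
    refine ENNReal.ofReal_le_ofReal ?_
    nlinarith [mul_nonneg (hf.nonneg y) (sq_nonneg (g y))]
  -- The Hellinger estimate divided by `t²` is `J / (σ (σ + t))`. The squared norm of the limit is
  -- its value at `t = 0`, hence the form `σ + 0`.
  have hD : ∫⁻ x, ENNReal.ofReal ((1 / 2 * scaleScoreAt f σ x * √(f (x / σ) / σ)) ^ 2) =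
      ENNReal.ofReal (1 / (σ * (σ + 0))) * J := by
    rw [hJ, ← lintegral_comp_div hσ (G := fun y => ENNReal.ofReal (g y ^ 2 * f y / 4)) (by fun_prop),
      ← lintegral_const_mul _ (by fun_prop)]
    refine lintegral_congr_ae ?_
    filter_upwards [ae_comp_div (scaleScore_ae_eq hint hdiff) hσ] with x hx
    rw [← ENNReal.ofReal_mul (by positivity), ← ENNReal.ofReal_mul (by positivity), mul_pow,
      Real.sq_sqrt (div_nonneg (hf.nonneg _) hσ.le), scaleScoreAt]
    congr 1
    by_cases h0 : f (x / σ) = 0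
    · simp [h0]
    · rw [hx h0]
      field_simp
      ring
  refine tendsto_lintegral_sq_sub_of_le
    (c := fun t => ENNReal.ofReal (1 / (σ * (σ + t))) * J) (fun t => by fun_prop) (by fun_prop)
    ?_ ?_ ?_ ?_
  · rw [hD]
    exact ENNReal.mul_ne_top ENNReal.ofReal_ne_top hJfin
  · have hpos : ∀ᶠ t in 𝓝[≠] (0 : ℝ), -σ < t :=
      nhdsWithin_le_nhds (lt_mem_nhds (by linarith))
    filter_upwards [hpos, self_mem_nhdsWithin] with t ht ht0
    have ht0 : t ≠ 0 := ht0
    have hσt : 0 < σ + t := by linarith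
    have h := lintegral_sq_sqrt_scaled_sub_le hfm hgm hf.nonneg hint hdiff hσt hσ
    simp only [mul_pow]
    calc _ = ENNReal.ofReal (t⁻¹ ^ 2) *
          ∫⁻ x, ENNReal.ofReal ((√(f (x / (σ + t)) / (σ + t)) - √(f (x / σ) / σ)) ^ 2) := by
          rw [← lintegral_const_mul _ (by fun_prop)]
          refine lintegral_congr fun x => ?_
          rw [ENNReal.ofReal_mul (by positivity)]
      _ ≤ ENNReal.ofReal (t⁻¹ ^ 2) *
          (ENNReal.ofReal ((σ - (σ + t)) ^ 2 / ((σ + t) * σ)) * J) := by gcongr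
      _ = _ := by
          rw [← mul_assoc, ← ENNReal.ofReal_mul (by positivity)]
          congr 2
          field_simp
          ring
  · rw [hD]
    refine ENNReal.Tendsto.mul_const (ENNReal.tendsto_ofReal ?_) (Or.inr hJfin)
    have hc : ContinuousAt (fun t : ℝ => 1 / (σ * (σ + t))) 0 :=
      ContinuousAt.div continuousAt_const (by fun_prop) (by simp [hσ.ne'])
    exact hc.tendsto.mono_left nhdsWithin_le_nhds
  · filter_upwards [ae_comp_div
      (ae_hasDerivAt_of_integral (m := fun x => x * f x) hint hdiff) hσ,
      Measure.ae_ne volume (0 : ℝ)] with x hx hx0 hv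
    -- Only points with nonzero limit matter, and there the density is positive.
    have hfx : 0 < f (x / σ) := by
      refine lt_of_le_of_ne (hf.nonneg _) fun h0 => hv ?_
      simp [← h0]
    have h1 := hasDerivAt_iff_tendsto_slope_zero.1 (hasDerivAt_sqrt_scaled hx0 hσ hfx hx)
    rw [scaleScoreAt, scaleScore, if_neg (div_ne_zero hx0 hσ.ne'), hx.deriv]
    exact h1

theorem proposition3p1 (F : Measure ℝ) [IsProbabilityMeasure F]
    (hF : fisherInfoScale F < ∞) :
    (∃ f : ℝ → ℝ, IsScaleDensity F f) ∧
      ∀ f : ℝ → ℝ, IsScaleDensity F f →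
        ∀ σ : ℝ, 0 < σ → HasL2DerivAt (scaleFamily F) (scaleScoreAt f σ) σ := by
  constructor
  · obtain ⟨f, -, hf, -⟩ := exists_isScaleDensity_and_score F hF
    exact ⟨f, hf⟩
  intro f hf σ hσ
  obtain ⟨g, hgm, hg2, hint, hdiff⟩ := hf.exists_score hF
  have hΛm : Measurable (scaleScore f) := measurable_scaleScore hf.measurable
  have hΛσm : Measurable (scaleScoreAt f σ) := by unfold scaleScoreAt; fun_prop
  constructor
  · rw [scaleFamily, memLp_map_measure_iff hΛσm.aestronglyMeasurable (by fun_prop)]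
    have : scaleScoreAt f σ ∘ (fun x => σ * x) = fun x => σ⁻¹ * scaleScore f x := by
      ext x
      simp only [Function.comp_apply, scaleScoreAt, mul_div_cancel_left₀ _ hσ.ne']
    rw [this]
    exact (hf.memLp_scaleScore hg2 hint hdiff).const_mul _
  · have hlim := hf.tendsto_lintegral_sq_slope hgm hg2 hint hdiff hσ
    rw [isLittleO_iff]
    intro c hc
    have hev := eventually_nhdsWithin_iff.1
      ((ENNReal.tendsto_nhds_zero.1 hlim) (ENNReal.ofReal (c ^ 2)) (by simpa using pow_pos hc 2))
    filter_upwards [hev, lt_mem_nhds (show -σ < 0 by linarith)] with t ht htσ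
    have hu0 : 1 + t / 2 * scaleScoreAt f σ 0 = 1 := by simp [scaleScoreAt, scaleScore]
    rw [hf.sqrtMeasureDist_eq hσ (by linarith) (by fun_prop) hu0,
      Real.norm_of_nonneg ENNReal.toReal_nonneg]
    refine ENNReal.toReal_le_of_le_ofReal (by positivity) ?_
    rw [one_div, ENNReal.rpow_inv_le_iff (by norm_num), ENNReal.rpow_two,
      ← ENNReal.ofReal_pow (by positivity)]
    -- Difference quotients are controlled only for `t ≠ 0`; at `t = 0` the integrand vanishes.
    by_cases ht0 : t = 0
    · simp [ht0]
    have ht := ht ht0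
    calc _ = ENNReal.ofReal (t ^ 2) * ∫⁻ x, ENNReal.ofReal
            ((t⁻¹ * (√(f (x / (σ + t)) / (σ + t)) - √(f (x / σ) / σ)) -
              1 / 2 * scaleScoreAt f σ x * √(f (x / σ) / σ)) ^ 2) := by
          have hfm := hf.measurable
          rw [← lintegral_const_mul _ (by fun_prop)]
          refine lintegral_congr fun x => ?_
          rw [← ENNReal.ofReal_mul (by positivity)]
          congr 1
          field_simp
          ring
      _ ≤ ENNReal.ofReal (t ^ 2) * ENNReal.ofReal (c ^ 2) := by gcongr
      _ = _ := by
          rw [← ENNReal.ofReal_mul (by positivity), mul_pow, Real.norm_eq_abs, sq_abs, mul_comm]
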